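/- Let $p$ be a prime, let $K/\mathbb{Q}_p$ be a finite extension with ramification index $e(K/\mathbb{Q}_p)=1$, ring of integers $\mathcal{O}_K$, maximal ideal $\mathfrak{m}$ and residue field $k$, and let $\overline{\mathbb{F}}$ be an algebraic closure of $\mathbb{F}_p$. Put $\Gamma=\mathrm{GL}_2(k)$, $\mathcal{K}=\mathrm{GL}_2(\mathcal{O}_K)$ and $\mathcal{K}_n=1+\mathfrak{m}^nM_2(\mathcal{O}_K)$ for $n\ge 1$. For integers $t_\kappa$ and $0\le s_\kappa\le p-1$ indexed by the embeddings $\kappa:k\to\overline{\mathbb{F}}$, let $$V_{t,s}=\bigotimes_{\kappa}\bigl(\det{}^{t_\kappa}\otimes\mathrm{Sym}^{s_\kappa}k^2\bigr)\otimes_{k,\kappa}\overline{\mathbb{F}},$$ a Serre weight, i.e. an irreducible representation of $\Gamma$; it is called weakly regular if $s_\kappa\le p-2$ for all $\kappa$. Representations of $\Gamma$ are regarded as representations of $\mathcal{K}$ and of $\mathcal{K}/\mathcal{K}_2$ by inflation. Let $\sigma$ and $\tau$ be non-isomorphic, weakly regular Serre weights such that $\sigma$ occurs in the continuous cohomology group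 $H^1(\mathcal{K}_1,\tau)$, that is, $\mathrm{Hom}_\Gamma(\sigma,H^1(\mathcal{K}_1,\tau))\ne 0$. Then the restriction map $$H^1(\mathcal{K}/\mathcal{K}_2,\sigma^\vee\otimes\tau)\to H^1(\mathcal{K}_1/\mathcal{K}_2,\sigma^\vee\otimes\tau)^{\Gamma}$$ is zero, and the inflation map $$H^1(\Gamma,\sigma^\vee\otimes\tau)\to H^1(\mathcal{K}/\mathcal{K}_2,\sigma^\vee\otimes\tau)$$ is an isomorphism. Moreover $\mathrm{Ext}^1_{\mathcal{K}}(\sigma,\tau)\ne 0$ (extensions of smooth $\overline{\mathbb{F}}$-representations of $\mathcal{K}$) if and only if $\mathrm{Ext}^1_{\Gamma}(\sigma,\tau)\ne 0$ (extensions of $\overline{\mathbb{F}}$-representations of $\Gamma$). -/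

import Mathlib

open scoped TensorProduct MatrixGroups

universe u

/-! ### The ring of integers of a finite extension of `ℚ_p` -/

section Integers

variable (p : ℕ) [Fact p.Prime] (K : Type u) [Field K] [Algebra ℚ_[p] K] [Algebra ℤ_[p] K]
  [IsScalarTower ℤ_[p] ℚ_[p] K]

/-- The valuation ring `𝒪_K` of a finite extension `K` of `ℚ_p`: the elements of `K` that are
integral over `ℤ_p`. -/
abbrev IntegerRing : Type u := integralClosure ℤ_[p] K

variable {p K}

theorem isIntegral_iff_spectralNorm_le_one [FiniteDimensional ℚ_[p] K] (x : K) :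
    IsIntegral ℤ_[p] x ↔ spectralNorm ℚ_[p] K x ≤ 1 := by
  have hx : IsIntegral ℚ_[p] x := Algebra.IsIntegral.isIntegral x
  rw [spectralNorm, spectralValue_le_one_iff (minpoly.monic hx)]
  constructor
  · intro h n
    rw [minpoly.isIntegrallyClosed_eq_field_fractions' ℚ_[p] h, Polynomial.coeff_map]
    exact PadicInt.norm_le_one _
  · intro h
    have hl : minpoly ℚ_[p] x ∈ Polynomial.lifts (algebraMap ℤ_[p] ℚ_[p]) := by
      rw [Polynomial.lifts_iff_coeff_lifts]
      exact fun n => ⟨⟨_, h n⟩, rfl⟩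
    obtain ⟨q, hq, -, hm⟩ := Polynomial.lifts_and_natDegree_eq_and_monic hl (minpoly.monic hx)
    refine ⟨q, hm, ?_⟩
    have h0 := minpoly.aeval ℚ_[p] x
    rw [← hq, Polynomial.aeval_map_algebraMap] at h0
    exact h0

/-- `𝒪_K` is a local ring. -/
instance integerRing_isLocalRing [FiniteDimensional ℚ_[p] K] : IsLocalRing (IntegerRing p K) := by
  have hmul : ∀ x y : K, spectralNorm ℚ_[p] K (x * y) =
      spectralNorm ℚ_[p] K x * spectralNorm ℚ_[p] K y := spectralAlgNorm_mul
  have key : ∀ a : IntegerRing p K, a ∈ nonunits (IntegerRing p K) ↔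
      spectralNorm ℚ_[p] K (a : K) < 1 := by
    intro a
    have ha := (isIntegral_iff_spectralNorm_le_one (a : K)).1 a.2
    constructor
    · intro hn
      refine lt_of_le_of_ne ha fun h1 => hn ?_
      have ha0 : (a : K) ≠ 0 := by
        intro h0
        rw [h0, spectralNorm_zero] at h1
        exact zero_ne_one h1
      have hi : spectralNorm ℚ_[p] K ((a : K)⁻¹) = 1 := by
        have := hmul (a : K) (a : K)⁻¹
        rw [mul_inv_cancel₀ ha0, spectralNorm_one, h1, one_mul] at this
        exact this.symm
      exact IsUnit.of_mul_eq_one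
        ⟨(a : K)⁻¹, (isIntegral_iff_spectralNorm_le_one _).2 hi.le⟩
        (Subtype.ext (mul_inv_cancel₀ ha0))
    · rintro hlt ⟨v, rfl⟩
      have h2 := hmul ((v : IntegerRing p K) : K) ((v⁻¹ : (IntegerRing p K)ˣ) : IntegerRing p K)
      have h3 : ((v : IntegerRing p K) : K) * ((v⁻¹ : (IntegerRing p K)ˣ) : IntegerRing p K) = 1 :=
        congrArg Subtype.val v.mul_inv
      rw [h3, spectralNorm_one] at h2
      have h4 := (isIntegral_iff_spectralNorm_le_one _).1
        ((v⁻¹ : (IntegerRing p K)ˣ) : IntegerRing p K).2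
      have h5 := spectralNorm_nonneg (K := ℚ_[p]) (L := K) ((v : IntegerRing p K) : K)
      nlinarith
  refine IsLocalRing.of_nonunits_add fun a b ha hb => ?_
  rw [key] at ha hb ⊢
  exact lt_of_le_of_lt (isNonarchimedean_spectralNorm (K := ℚ_[p]) (L := K) (a : K) (b : K))
    (max_lt ha hb)

end Integers

/-! ### Serre weights -/

section SerreWeights

variable {F : Type u} [Field F]

/-- The algebra endomorphism of `F[X₀, X₁]` sending the `j`-th variable (the `j`-th standard basis
vector) to its image `∑ i, g i j • X i` under the matrix `g`. -/
noncomputable def symAlgHom (g : Matrix (Fin 2) (Fin 2) F) :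
    MvPolynomial (Fin 2) F →ₐ[F] MvPolynomial (Fin 2) F :=
  MvPolynomial.aeval fun j => ∑ i, MvPolynomial.C (g i j) * MvPolynomial.X i

theorem symAlgHom_X (g : Matrix (Fin 2) (Fin 2) F) (j : Fin 2) :
    symAlgHom g (MvPolynomial.X j) = ∑ i, MvPolynomial.C (g i j) * MvPolynomial.X i := by
  simp [symAlgHom]

theorem symAlgHom_one : symAlgHom (1 : Matrix (Fin 2) (Fin 2) F) = AlgHom.id F _ := by
  ext j : 1
  rw [symAlgHom_X]
  fin_cases j <;> simp [Matrix.one_apply]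

theorem symAlgHom_mul (g h : Matrix (Fin 2) (Fin 2) F) :
    symAlgHom (g * h) = (symAlgHom g).comp (symAlgHom h) := by
  ext j : 1
  rw [AlgHom.comp_apply, symAlgHom_X, symAlgHom_X, map_sum]
  simp only [map_mul, map_add, symAlgHom_X, MvPolynomial.algHom_C,
    MvPolynomial.algebraMap_eq, Matrix.mul_apply, Fin.sum_univ_two]
  ring

theorem symAlgHom_mem (g : Matrix (Fin 2) (Fin 2) F) (s : ℕ) (P : MvPolynomial (Fin 2) F)
    (hP : P ∈ MvPolynomial.homogeneousSubmodule (Fin 2) F s) :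
    symAlgHom g P ∈ MvPolynomial.homogeneousSubmodule (Fin 2) F s := by
  rw [MvPolynomial.mem_homogeneousSubmodule] at hP ⊢
  have h := hP.aeval (fun j => ∑ i, MvPolynomial.C (g i j) * MvPolynomial.X i) (n := 1) fun j =>
    MvPolynomial.IsHomogeneous.sum _ _ _ fun i _ => by
      simpa using (MvPolynomial.isHomogeneous_C (Fin 2) (g i j)).mul
        (MvPolynomial.isHomogeneous_X F i)
  rwa [one_mul] at h

/-- `Sym^s F²`, realised on homogeneous polynomials of degree `s` in two variables, as a
representation of `GL₂(F)`. -/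
noncomputable def symRep (s : ℕ) :
    Representation F (GL (Fin 2) F) (MvPolynomial.homogeneousSubmodule (Fin 2) F s) where
  toFun g := (symAlgHom (g : Matrix (Fin 2) (Fin 2) F)).toLinearMap.restrict (symAlgHom_mem _ s)
  map_one' := by
    ext P : 2
    simp [LinearMap.restrict_apply, symAlgHom_one]
  map_mul' g h := by
    ext P : 2
    simp only [Units.val_mul, symAlgHom_mul]
    rfl

/-- `det^t ⊗ Sym^s F²` as a representation of `GL₂(F)`, on the space of `Sym^s F²`. -/
noncomputable def detSymRep (t : ℤ) (s : ℕ) :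
    Representation F (GL (Fin 2) F) (MvPolynomial.homogeneousSubmodule (Fin 2) F s) where
  toFun g := ((Matrix.GeneralLinearGroup.det g ^ t : Fˣ) : F) • symRep s g
  map_one' := by simp
  map_mul' g h := by
    simp only [map_mul, mul_zpow, Units.val_mul]
    rw [smul_mul_smul_comm]

variable (k : Type u) [Field k]

/-- The underlying space of the Serre weight `V_{t,s}`. -/
def SerreSpace (F : Type u) [Field F] (k : Type u) [Field k] (s : (k →+* F) → ℕ) : Type u :=
  ⨂[F] κ : k →+* F, MvPolynomial.homogeneousSubmodule (Fin 2) F (s κ)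

noncomputable instance (s : (k →+* F) → ℕ) : AddCommGroup (SerreSpace F k s) :=
  inferInstanceAs (AddCommGroup
    (⨂[F] κ : k →+* F, MvPolynomial.homogeneousSubmodule (Fin 2) F (s κ)))

noncomputable instance (s : (k →+* F) → ℕ) : Module F (SerreSpace F k s) :=
  inferInstanceAs (Module F
    (⨂[F] κ : k →+* F, MvPolynomial.homogeneousSubmodule (Fin 2) F (s κ)))

variable {k}

/-- The representation `V_{t,s} = ⨂_κ (det^{t_κ} ⊗ Sym^{s_κ} k²) ⊗_{k,κ} F` of `GL₂(k)`, the tensor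
product running over all embeddings `κ : k → F`; on the factor at `κ` the group `GL₂(k)` acts
through `GL₂(κ) : GL₂(k) → GL₂(F)`. For `k` finite of characteristic `p`, `F` an algebraic closure
of `𝔽_p` and `0 ≤ s_κ ≤ p - 1`, these are the Serre weights. -/
noncomputable def serreWeight (t : (k →+* F) → ℤ) (s : (k →+* F) → ℕ) :
    Representation F (GL (Fin 2) k) (SerreSpace F k s) where
  toFun g := PiTensorProduct.map fun κ =>
    detSymRep (t κ) (s κ) (Matrix.GeneralLinearGroup.map κ g)
  map_one' := by
    simp only [map_one]
    exact PiTensorProduct.map_one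
  map_mul' g h := by
    simp only [map_mul]
    exact PiTensorProduct.map_mul _ _

end SerreWeights

/-! ### `GL₂` of a local ring, congruence subgroups, smooth representations -/

section Groups

variable (O : Type u) [CommRing O] [IsLocalRing O]

/-- The principal congruence subgroup `𝒦_n = 1 + 𝔪^n M₂(O)` (for `n ≥ 1`) of `GL₂(O)`: the kernel
of `GL₂(O) → GL₂(O/𝔪^n)`. -/
def congruenceSubgroup (n : ℕ) : Subgroup (GL (Fin 2) O) :=
  (Matrix.GeneralLinearGroup.map (n := Fin 2)
    (Ideal.Quotient.mk (IsLocalRing.maximalIdeal O ^ n))).ker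

instance (n : ℕ) : (congruenceSubgroup O n).Normal :=
  inferInstanceAs (MonoidHom.ker _).Normal

/-- Reduction `GL₂(O) → Γ = GL₂(k)`, where `k` is the residue field of `O`. -/
noncomputable def reductionHom : GL (Fin 2) O →* GL (Fin 2) (IsLocalRing.ResidueField O) :=
  Matrix.GeneralLinearGroup.map (IsLocalRing.residue O)

theorem mem_congruenceSubgroup_iff (n : ℕ) (g : GL (Fin 2) O) :
    g ∈ congruenceSubgroup O n ↔
      ∀ i j, g i j - (1 : Matrix (Fin 2) (Fin 2) O) i j ∈ IsLocalRing.maximalIdeal O ^ n := by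
  rw [congruenceSubgroup, MonoidHom.mem_ker, Matrix.GeneralLinearGroup.ext_iff]
  refine forall₂_congr fun i j => ?_
  rw [← Ideal.Quotient.eq, Matrix.GeneralLinearGroup.map_apply]
  have : (Ideal.Quotient.mk (IsLocalRing.maximalIdeal O ^ n))
      ((1 : Matrix (Fin 2) (Fin 2) O) i j) = ((1 : GL (Fin 2) (O ⧸ IsLocalRing.maximalIdeal O ^ n)) :
        Matrix (Fin 2) (Fin 2) (O ⧸ IsLocalRing.maximalIdeal O ^ n)) i j := by
    by_cases hij : i = j <;> simp [Matrix.one_apply, hij]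
  rw [this]

theorem congruenceSubgroup_two_le : congruenceSubgroup O 2 ≤ (reductionHom O).ker := by
  intro g hg
  rw [MonoidHom.mem_ker, Matrix.GeneralLinearGroup.ext_iff]
  intro i j
  have h := Ideal.pow_le_self two_ne_zero ((mem_congruenceSubgroup_iff O 2 g).1 hg i j)
  rw [← IsLocalRing.residue_eq_zero_iff, map_sub, sub_eq_zero] at h
  rw [reductionHom, Matrix.GeneralLinearGroup.map_apply, h]
  simp [Matrix.one_apply, apply_ite]

/-- The finite group `𝒦/𝒦₂`. -/
abbrev QuotTwo : Type u := GL (Fin 2) O ⧸ congruenceSubgroup O 2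

/-- The projection `𝒦/𝒦₂ → Γ`. -/
noncomputable def quotTwoToResidue : QuotTwo O →* GL (Fin 2) (IsLocalRing.ResidueField O) :=
  QuotientGroup.lift (congruenceSubgroup O 2) (reductionHom O) fun _ hg =>
    congruenceSubgroup_two_le O hg

/-- The subgroup `𝒦₁/𝒦₂` of `𝒦/𝒦₂`. -/
def kernelModTwo : Subgroup (QuotTwo O) :=
  (congruenceSubgroup O 1).map (QuotientGroup.mk' (congruenceSubgroup O 2))

variable {O} {F : Type u} [Field F]

/-- A representation of `GL₂(O)` is smooth if every vector is fixed by an open subgroup, i.e. by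
some principal congruence subgroup (these form a basis of neighbourhoods of `1`). -/
def IsSmoothRep {V : Type u} [AddCommGroup V] [Module F V]
    (ρ : Representation F (GL (Fin 2) O) V) : Prop :=
  ∀ v, ∃ n, ∀ g ∈ congruenceSubgroup O n, ρ g v = v

/-- Inflation of a representation of `Γ = GL₂(k)` to `GL₂(O)`. -/
noncomputable def inflate {V : Type u} [AddCommGroup V] [Module F V]
    (ρ : Representation F (GL (Fin 2) (IsLocalRing.ResidueField O)) V) :
    Representation F (GL (Fin 2) O) V :=
  ρ.comp (reductionHom O)

end Groups

/-! ### Continuous first cohomology of the first congruence subgroup -/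

section ContinuousCohomology

variable {O : Type u} [CommRing O] [IsLocalRing O] {F : Type u} [Field F]
  {V : Type u} [AddCommGroup V] [Module F V] (ρ : Representation F (GL (Fin 2) O) V)

/-- Continuous `1`-cocycles `𝒦₁ → V`, for the discrete topology on `V` (the second condition says
that the cocycle factors through `𝒦₁/(𝒦₁ ∩ 𝒦_n)` for some `n`). -/
def contCocycles : Submodule F (congruenceSubgroup O 1 → V) where
  carrier := {c | (∀ g h, c (g * h) = c g + ρ g (c h)) ∧
    ∃ n, ∀ g h : congruenceSubgroup O 1, (h : GL (Fin 2) O) ∈ congruenceSubgroup O n →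
      c (g * h) = c g}
  zero_mem' := ⟨by simp, 0, by simp⟩
  add_mem' := by
    rintro a b ⟨ha, n, hn⟩ ⟨hb, m, hm⟩
    refine ⟨fun g h => ?_, max n m, fun g h hh => ?_⟩
    · simp only [Pi.add_apply, ha, hb, map_add]
      abel
    · rw [mem_congruenceSubgroup_iff] at hh
      simp only [Pi.add_apply]
      rw [hn g h ((mem_congruenceSubgroup_iff O n _).2 fun i j =>
          Ideal.pow_le_pow_right (le_max_left n m) (hh i j)),
        hm g h ((mem_congruenceSubgroup_iff O m _).2 fun i j =>
          Ideal.pow_le_pow_right (le_max_right n m) (hh i j))]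
  smul_mem' := by
    rintro r a ⟨ha, n, hn⟩
    refine ⟨fun g h => ?_, n, fun g h hh => ?_⟩
    · simp [ha]
    · simp [hn g h hh]

/-- The `1`-coboundaries `g ↦ g v - v`. -/
def contCoboundaries : Submodule F (contCocycles ρ) where
  carrier := {c | ∃ v, ∀ g, c.1 g = ρ g v - v}
  zero_mem' := ⟨0, by simp⟩
  add_mem' := by
    rintro a b ⟨v, hv⟩ ⟨w, hw⟩
    refine ⟨v + w, fun g => ?_⟩
    simp only [Submodule.coe_add, Pi.add_apply, hv, hw, map_add]
    abel
  smul_mem' := by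
    rintro r a ⟨v, hv⟩
    exact ⟨r • v, fun g => by simp [hv, smul_sub]⟩

/-- The continuous cohomology group `H¹(𝒦₁, V)`. -/
abbrev ContH1 : Type u := contCocycles ρ ⧸ contCoboundaries ρ

/-- Conjugation `g ↦ x⁻¹ g x` on `𝒦₁`. -/
def conjInv (x : GL (Fin 2) O) (g : congruenceSubgroup O 1) : congruenceSubgroup O 1 :=
  ⟨x⁻¹ * g * x, by
    simpa using (inferInstance : (congruenceSubgroup O 1).Normal).conj_mem _ g.2 x⁻¹⟩

theorem conjInv_mul (x : GL (Fin 2) O) (g h : congruenceSubgroup O 1) :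
    conjInv x (g * h) = conjInv x g * conjInv x h := by
  apply Subtype.ext
  simp [conjInv, mul_assoc]

/-- The action of `GL₂(O)` on cocycles: `(x c)(g) = x (c (x⁻¹ g x))`. -/
def cocycleRep : Representation F (GL (Fin 2) O) (contCocycles ρ) where
  toFun x :=
    { toFun := fun c => ⟨fun g => ρ x (c.1 (conjInv x g)), by
        obtain ⟨c, hc, n, hn⟩ := c
        refine ⟨fun g h => ?_, n, fun g h hh => ?_⟩
        · simp only [conjInv_mul, hc, map_add]
          congr 1
          simp only [conjInv, ← Module.End.mul_apply, ← map_mul]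
          congr 2
          simp [mul_assoc]
        · simp only [conjInv_mul]
          rw [hn]
          simpa [conjInv] using
            (inferInstance : (congruenceSubgroup O n).Normal).conj_mem _ hh x⁻¹⟩
      map_add' := fun a b => by
        apply Subtype.ext
        funext g
        simp
      map_smul' := fun r a => by
        apply Subtype.ext
        funext g
        simp }
  map_one' := by
    ext c : 2
    funext g
    simp [conjInv]
  map_mul' x y := by
    ext c : 2
    funext g
    simp [conjInv, mul_assoc]

/-- The resulting action of `GL₂(O)` on `H¹(𝒦₁, V)`. It factors through `Γ = GL₂(O)/𝒦₁`. -/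
def contH1Rep : Representation F (GL (Fin 2) O) (ContH1 ρ) where
  toFun x := (contCoboundaries ρ).mapQ (contCoboundaries ρ) (cocycleRep ρ x) (by
    rintro c ⟨v, hv⟩
    refine ⟨ρ x v, fun g => ?_⟩
    simp only [cocycleRep, MonoidHom.coe_mk, OneHom.coe_mk, LinearMap.coe_mk, AddHom.coe_mk, hv,
      map_sub]
    congr 1
    simp only [conjInv, ← Module.End.mul_apply, ← map_mul]
    congr 2
    simp [mul_assoc])
  map_one' := by
    apply Submodule.linearMap_qext
    ext c : 1
    simp
  map_mul' x y := by
    apply Submodule.linearMap_qext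
    ext c : 1
    simp

/-- `σ` occurs in `H¹(𝒦₁, τ)`, i.e. `Hom_Γ(σ, H¹(𝒦₁, τ)) ≠ 0`. (As `𝒦₁` acts trivially on both
sides and `GL₂(O) → Γ` is onto, a `Γ`-map is the same as a `GL₂(O)`-map.) -/
def OccursInH1 {W : Type u} [AddCommGroup W] [Module F W]
    (σ : Representation F (GL (Fin 2) (IsLocalRing.ResidueField O)) W)
    (τ : Representation F (GL (Fin 2) (IsLocalRing.ResidueField O)) V) : Prop :=
  ∃ φ : (inflate (O := O) σ).IntertwiningMap (contH1Rep (inflate (O := O) τ)), φ ≠ 0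

end ContinuousCohomology

/-! ### Extensions -/

section Extensions

variable {F : Type u} [Field F] {G : Type u} [Group G]
  {V W : Type u} [AddCommGroup V] [Module F V] [AddCommGroup W] [Module F W]

/-- An extension `0 → τ → E → σ → 0` of representations of `G`. -/
structure RepExtension (σ : Representation F G V) (τ : Representation F G W) where
  /-- the middle term -/
  E : Type u
  [addCommGroup : AddCommGroup E]
  [module : Module F E]
  /-- the action on the middle term -/
  ρ : Representation F G E
  /-- the inclusion of `τ` -/
  incl : τ.IntertwiningMap ρ
  /-- the projection onto `σ` -/
  proj : ρ.IntertwiningMap σ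
  injective : Function.Injective incl
  exact : Function.Exact incl proj
  surjective : Function.Surjective proj

attribute [instance] RepExtension.addCommGroup RepExtension.module

/-- The extension splits: its class in `Ext¹` is zero. -/
def RepExtension.Splits {σ : Representation F G V} {τ : Representation F G W}
    (X : RepExtension σ τ) : Prop :=
  ∃ r : σ.IntertwiningMap X.ρ, ∀ v, X.proj (r v) = v

/-- `Ext¹_G(σ, τ) ≠ 0` in the category of all `F`-linear representations of `G`, in terms of Yoneda
extension classes: some extension of `σ` by `τ` has non-zero class. -/
def ExtNeZero (σ : Representation F G V) (τ : Representation F G W) : Prop :=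
  ∃ X : RepExtension σ τ, ¬ X.Splits

/-- `Ext¹_{GL₂(O)}(σ, τ) ≠ 0` in the category of smooth `F`-linear representations of `GL₂(O)`, in
terms of Yoneda extension classes. -/
def SmoothExtNeZero {O : Type u} [CommRing O] [IsLocalRing O]
    (σ : Representation F (GL (Fin 2) O) V) (τ : Representation F (GL (Fin 2) O) W) : Prop :=
  ∃ X : RepExtension σ τ, IsSmoothRep X.ρ ∧ ¬ X.Splits

end Extensions

/-! ### Inflation and restriction for `1 → 𝒦₁/𝒦₂ → 𝒦/𝒦₂ → Γ → 1` -/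

section InfRes

variable {O : Type u} [CommRing O] [IsLocalRing O] {F : Type u} [Field F]
  {V W : Type u} [AddCommGroup V] [Module F V] [AddCommGroup W] [Module F W]
  (σ : Representation F (GL (Fin 2) (IsLocalRing.ResidueField O)) V)
  (τ : Representation F (GL (Fin 2) (IsLocalRing.ResidueField O)) W)

/-- `σ^∨ ⊗ τ` as a representation of `Γ`. -/
noncomputable abbrev dualTensor : Rep.{u} F (GL (Fin 2) (IsLocalRing.ResidueField O)) :=
  Rep.of (X := Module.Dual F V ⊗[F] W) (σ.dual.tprod τ)

/-- `σ^∨ ⊗ τ` as a representation of `𝒦/𝒦₂`. -/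
noncomputable abbrev dualTensorQuotTwo : Rep.{u} F (QuotTwo O) :=
  Rep.res (quotTwoToResidue O) (dualTensor σ τ)

/-- Inflation `H¹(Γ, σ^∨ ⊗ τ) → H¹(𝒦/𝒦₂, σ^∨ ⊗ τ)`. -/
noncomputable def infMap :
    groupCohomology (dualTensor σ τ) 1 ⟶ groupCohomology (dualTensorQuotTwo σ τ) 1 :=
  groupCohomology.map (quotTwoToResidue O) (CategoryTheory.CategoryStruct.id _) 1

/-- Restriction `H¹(𝒦/𝒦₂, σ^∨ ⊗ τ) → H¹(𝒦₁/𝒦₂, σ^∨ ⊗ τ)`. Its image lies in the `Γ`-invariants. -/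
noncomputable def resMap :
    groupCohomology (dualTensorQuotTwo σ τ) 1 ⟶
      groupCohomology (Rep.res (kernelModTwo O).subtype (dualTensorQuotTwo σ τ)) 1 :=
  groupCohomology.map (kernelModTwo O).subtype (CategoryTheory.CategoryStruct.id _) 1

end InfRes

/-! All three conclusions follow from one fact, `RepExtension.ρ_eq_one_of_mem`: `𝒦₁` acts trivially
on every smooth extension `E` of `σ` by `τ`. Such extensions are then extensions of
`Γ`-representations. A cocycle of `𝒦/𝒦₂` in `σ^∨ ⊗ τ` is the off-diagonal block of such an `E`, so
it vanishes on `𝒦₁/𝒦₂` and descends to `Γ`.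

For the fact itself, write `g ∈ 𝒦₁` on `E` as `1 + N_g`, where `N_g : σ → τ` is `defect`. Then `g ↦
N_g` is a homomorphism, equivariant for conjugation.

Case `p = 2`: weak regularity makes `σ` and `τ` powers of the determinant. A nonzero `N_g` would
force equal central characters. Every element of `kˣ` is a square, so `σ ≅ τ`, a contradiction
(`defect_eq_zero_of_two`).

Case `p` odd: `N` kills `p`-th powers, so by smoothness it kills `𝒦₂`. As `p` is a uniformizer, `N`
becomes an additive equivariant map on `M₂(k)` (`matDefect`), which splits into `κ`-semilinear
components. Let `y`, `yh`, `yf` be the values of the `κ`-component at the matrices `e`, `h`, `f` of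
`sl₂`, applied to the lowest weight vector of `σ`. The key is `y = 0` (`component_single_eq_zero`),
by playing two constraints against each other.

The first constraint comes from the group structure of `E`. Let `κ = μ^p` and let `T = ∑ μ(x)⁻¹
u(x̃)` be the raising operator lifted to `E`. Its `p`-th power is the `κ`-component of `N` at `e`
(`liftedRaising_pow_char`). But `T^(s_μ+1)` already sends a lift of the lowest weight vector into
`τ`. So `y` lies in the image of the `(p-1-s_μ)`-th power of the raising operator of `τ`, a positive
power by weak regularity (`exists_component_eq_raising_pow`).

The second constraint is highest weight theory. The vector `yf` is fixed by the lower unipotents. If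
`yf = 0`, then `yh` is a lowest weight vector in `τ` of the weight of `σ`, so it vanishes, and then
`y` lies on the lowest weight line, against the first constraint unless `y = 0`. If `yf ≠ 0`, torus
weights put `y` at index `2` at `κ`, which forces `μ = κ`, `k = 𝔽_p` and incompatible sizes of `s`
and `s'`.

From `y = 0`, generation by the lowest weight vector gives `N = 0` on `e`. Conjugation gives `f` and
`h`, and scalar matrices would give a `Γ`-map `σ → τ`, which is zero. -/

set_option linter.unusedSectionVars false

/-! ### Characters of a finite field -/

section FiniteFieldCharacters

variable (p : ℕ) [Fact p.Prime] {k F : Type u} [Field k] [Fintype k] [CharP k p] [Field F]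
  [CharP F p] [IsAlgClosed F]

/-- In characteristic `p`, ring homomorphisms are the same as `𝔽_p`-algebra homomorphisms. -/
def ringHomEquivAlgHom (p : ℕ) (k F : Type u) [Field k] [Field F] [Algebra (ZMod p) k]
    [Algebra (ZMod p) F] : (k →+* F) ≃ (k →ₐ[ZMod p] F) where
  toFun φ := AlgHom.mk φ fun r => RingHom.congr_fun
    (RingHom.ext_zmod (φ.comp (algebraMap (ZMod p) k)) (algebraMap (ZMod p) F)) r
  invFun φ := φ
  left_inv φ := by ext x; rfl
  right_inv φ := by ext x; rfl

theorem finite_ringHom_of_charP (p : ℕ) [Fact p.Prime] (k F : Type u) [Field k] [Finite k]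
    [CharP k p] [Field F] [CharP F p] : Finite (k →+* F) := by
  let _ := ZMod.algebra k p
  let _ := ZMod.algebra F p
  exact Finite.of_equiv _ (ringHomEquivAlgHom p k F).symm

theorem card_ringHom_eq_finrank [Algebra (ZMod p) k] [Fintype (k →+* F)] :
    Fintype.card (k →+* F) = Module.finrank (ZMod p) k := by
  let _ := ZMod.algebra F p
  rw [← AlgHom.card (ZMod p) k F]
  exact Fintype.card_congr (ringHomEquivAlgHom p k F)

/-- All embeddings are Frobenius twists of a single one, because the powers of Frobenius exhaust the
automorphisms of `k`. This turns a family of exponents indexed by embeddings into the base `p`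
digits of one exponent of `κ₀`. -/
theorem exists_equiv_embeddings [Fintype (k →+* F)] :
    ∃ (f : ℕ) (κ₀ : k →+* F) (e : Fin f ≃ (k →+* F)), 0 < f ∧ Fintype.card k = p ^ f ∧
      ∀ n x, e n x = κ₀ x ^ p ^ (n : ℕ) := by
  let _ := ZMod.algebra k p
  have hc := card_ringHom_eq_finrank p (k := k) (F := F)
  have hpos : 0 < Module.finrank (ZMod p) k := Module.finrank_pos
  obtain ⟨κ₀⟩ : Nonempty (k →+* F) := Fintype.card_pos_iff.1 (hc ▸ hpos)
  have hbij := FiniteField.bijective_frobeniusAlgHom_pow (ZMod p) k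
  have hb : Function.Bijective (fun n : Fin (Module.finrank (ZMod p) k) =>
      κ₀.comp ((FiniteField.frobeniusAlgHom (ZMod p) k ^ (n : ℕ) : k →ₐ[ZMod p] k) : k →+* k)) := by
    rw [Fintype.bijective_iff_injective_and_card]
    refine ⟨fun m n h => hbij.1 ?_, by simp [hc]⟩
    ext x
    exact κ₀.injective (RingHom.congr_fun h x)
  refine ⟨_, κ₀, Equiv.ofBijective _ hb, hpos, ?_, fun n x => ?_⟩
  · rw [Module.card_eq_pow_finrank (K := ZMod p), ZMod.card]
  · simp [AlgHom.coe_pow, FiniteField.coe_frobeniusAlgHom, pow_iterate]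

/-- The function `x ↦ ∏_κ κ(x)^{j_κ}` on `k`. -/
def embProd [Fintype (k →+* F)] (j : (k →+* F) → ℕ) (x : k) : F := ∏ κ, κ x ^ j κ

section

variable [Fintype (k →+* F)]

theorem embProd_zero (x : k) : embProd (0 : (k →+* F) → ℕ) x = 1 := by simp [embProd]

theorem embProd_add (i j : (k →+* F) → ℕ) (x : k) :
    embProd (i + j) x = embProd i x * embProd j x := by
  simp [embProd, pow_add, Finset.prod_mul_distrib]

theorem embProd_single [DecidableEq (k →+* F)] (κ : k →+* F) (n : ℕ) (x : k) :
    embProd (Pi.single κ n) x = κ x ^ n := by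
  rw [embProd, Finset.prod_eq_single κ] <;> simp +contextual

theorem embProd_ne_zero (j : (k →+* F) → ℕ) {x : k} (hx : x ≠ 0) : embProd j x ≠ 0 :=
  Finset.prod_ne_zero_iff.2 fun κ _ => pow_ne_zero _ ((map_ne_zero κ).2 hx)

theorem embProd_one (j : (k →+* F) → ℕ) : embProd j 1 = 1 := by simp [embProd]

theorem embProd_mul (j : (k →+* F) → ℕ) (x y : k) :
    embProd j (x * y) = embProd j x * embProd j y := by
  simp [embProd, mul_pow, Finset.prod_mul_distrib]

/-- Uniqueness of base `p` digits, in terms of characters of `kˣ`. -/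
theorem eq_or_of_embProd_eq {i j : (k →+* F) → ℕ} (hi : ∀ κ, i κ < p) (hj : ∀ κ, j κ < p)
    (h : ∀ x : k, x ≠ 0 → embProd i x = embProd j x) :
    i = j ∨ (i = 0 ∧ ∀ κ, j κ = p - 1) ∨ (j = 0 ∧ ∀ κ, i κ = p - 1) := by
  classical
  obtain ⟨f, κ₀, e, hf, hcard, he⟩ := exists_equiv_embeddings p (k := k) (F := F)
  have hp : 1 < p := (Fact.out : p.Prime).one_lt
  -- `finFunctionFinEquiv` assembles the digits `l (e n)` into the integer `∑ l (e n) p^n`.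
  have hval : ∀ (l : (k →+* F) → ℕ) (hl : ∀ κ, l κ < p) (x : k),
      embProd l x = κ₀ x ^ (finFunctionFinEquiv (fun n => (⟨l (e n), hl _⟩ : Fin p)) : ℕ) := by
    intro l hl x
    rw [finFunctionFinEquiv_apply, embProd, ← e.prod_comp, ← Finset.prod_pow_eq_pow_sum]
    refine Finset.prod_congr rfl fun n _ => ?_
    rw [he, ← pow_mul, mul_comm]
  obtain ⟨g, hg⟩ := IsCyclic.exists_generator (α := kˣ)
  have hord : orderOf g = p ^ f - 1 := by
    rw [orderOf_eq_card_of_forall_mem_zpowers hg, Nat.card_units, Nat.card_eq_fintype_card, hcard]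
  set a := finFunctionFinEquiv (fun n => (⟨i (e n), hi _⟩ : Fin p)) with ha
  set b := finFunctionFinEquiv (fun n => (⟨j (e n), hj _⟩ : Fin p)) with hb
  have hmod : (a : ℕ) ≡ b [MOD (p ^ f - 1)] := by
    rw [← hord, ← pow_eq_pow_iff_modEq]
    have := h g g.ne_zero
    rw [hval i hi, hval j hj, ← map_pow, ← map_pow] at this
    exact Units.ext (by rw [Units.val_pow_eq_pow_val, Units.val_pow_eq_pow_val]
                        exact κ₀.injective this)
  have hpf : 1 < p ^ f := Nat.one_lt_pow hf.ne' hp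
  have hzero : ∀ (l : (k →+* F) → ℕ) (hl : ∀ κ, l κ < p),
      ((finFunctionFinEquiv (fun n => (⟨l (e n), hl _⟩ : Fin p)) : Fin (p ^ f)) : ℕ) = 0 →
        l = 0 := by
    intro l hl h0
    rw [finFunctionFinEquiv_apply, Finset.sum_eq_zero_iff] at h0
    funext κ
    have := h0 (e.symm κ) (Finset.mem_univ _)
    simpa [(Fact.out : p.Prime).ne_zero] using this
  have htop : ∀ (l : (k →+* F) → ℕ) (hl : ∀ κ, l κ < p),
      ((finFunctionFinEquiv (fun n => (⟨l (e n), hl _⟩ : Fin p)) : Fin (p ^ f)) : ℕ)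
        = p ^ f - 1 → ∀ κ, l κ = p - 1 := by
    intro l hl h0
    have h1 : ((finFunctionFinEquiv (fun _ => (⟨p - 1, by omega⟩ : Fin p)) : Fin (p ^ f)) : ℕ)
        = p ^ f - 1 := by
      rw [finFunctionFinEquiv_apply]
      simp only
      rw [← Finset.mul_sum, Fin.sum_univ_eq_sum_range (fun n => p ^ n), mul_comm,
        Nat.geomSum_eq hp, Nat.div_mul_cancel (Nat.sub_one_dvd_pow_sub_one _ _)]
    have h2 := finFunctionFinEquiv.injective (Fin.ext (h0.trans h1.symm))
    intro κ
    simpa using congrArg Fin.val (congrFun h2 (e.symm κ))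
  -- Two integers in `[0, p^f - 1]` congruent modulo `p^f - 1` are equal or are the two endpoints.
  have hab : (a : ℕ) = b ∨ ((a : ℕ) = 0 ∧ (b : ℕ) = p ^ f - 1) ∨
      ((b : ℕ) = 0 ∧ (a : ℕ) = p ^ f - 1) := by
    have ha' := a.2
    have hb' := b.2
    rcases Nat.lt_trichotomy (a : ℕ) b with hlt | heq | hlt
    · obtain ⟨c, hc⟩ := (Nat.modEq_iff_dvd' hlt.le).1 hmod
      have : c ≠ 0 := by rintro rfl; omega
      have : p ^ f - 1 ≤ (b : ℕ) - a := hc ▸ Nat.le_mul_of_pos_right _ (by omega)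
      omega
    · exact Or.inl heq
    · obtain ⟨c, hc⟩ := (Nat.modEq_iff_dvd' hlt.le).1 hmod.symm
      have : c ≠ 0 := by rintro rfl; omega
      have : p ^ f - 1 ≤ (a : ℕ) - b := hc ▸ Nat.le_mul_of_pos_right _ (by omega)
      omega
  rcases hab with hab | ⟨h0, h1⟩ | ⟨h0, h1⟩
  · left
    have h2 := finFunctionFinEquiv.injective (Fin.ext hab)
    funext κ
    simpa using congrArg Fin.val (congrFun h2 (e.symm κ))
  · exact Or.inr (Or.inl ⟨hzero i hi h0, htop j hj h1⟩)
  · exact Or.inr (Or.inr ⟨hzero j hj h0, htop i hi h1⟩)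

theorem eq_of_embProd_eq (hp2 : 2 < p) {i j : (k →+* F) → ℕ} (hi : ∀ κ, i κ ≤ p - 2)
    (hj : ∀ κ, j κ ≤ p - 2) (h : ∀ x : k, x ≠ 0 → embProd i x = embProd j x) : i = j := by
  obtain ⟨f, κ₀, e, hf, -, -⟩ := exists_equiv_embeddings p (k := k) (F := F)
  rcases eq_or_of_embProd_eq p (fun κ => (hi κ).trans_lt (by omega))
    (fun κ => (hj κ).trans_lt (by omega)) h with h | ⟨-, h⟩ | ⟨-, h⟩
  · exact h
  · have := h κ₀; have := hj κ₀; omega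
  · have := h κ₀; have := hi κ₀; omega

theorem sum_eq_sum_units {k : Type*} [Field k] [Fintype k] [DecidableEq k] {M : Type*} [AddCommMonoid M] (g : k → M) (h0 : g 0 = 0) :
    ∑ x, g x = ∑ x : kˣ, g x := by
  rw [← Finset.sum_erase Finset.univ h0]
  refine (Finset.sum_bij (fun (x : kˣ) _ => (x : k)) ?_ ?_ ?_ ?_).symm
  · intro x _; simp
  · intro x _ y _ h; exact Units.ext h
  · intro y hy; exact ⟨Units.mk0 y (by simpa using hy), Finset.mem_univ _, rfl⟩
  · intro x _; rfl

theorem sum_unitsHom (p : ℕ) [Fact p.Prime] {k F : Type*} [Field k] [Fintype k] [CharP k p] [Field F]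
    [CharP F p] (χ : kˣ →* F) [Decidable (χ = 1)] [DecidableEq k] :
    ∑ x : kˣ, χ x = if χ = 1 then -1 else 0 := by
  rw [sum_hom_units]
  obtain ⟨n, -, h⟩ := FiniteField.card k p
  have hk : ((Fintype.card k : ℕ) : F) = 0 := by simp [h, CharP.cast_eq_zero]
  rw [Fintype.card_units, Nat.cast_ite, Nat.cast_sub Fintype.card_pos, hk]
  simp

/-- Orthogonality of characters. -/
theorem sum_inv_mul_embProd [DecidableEq (k →+* F)] (hp2 : 2 < p) (κ : k →+* F)
    {j : (k →+* F) → ℕ} (hj : ∀ ν, j ν ≤ p - 2) :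
    ∑ x : k, (κ x)⁻¹ * embProd j x = if j = Pi.single κ 1 then -1 else 0 := by
  classical
  -- The convention `0⁻¹ = 0` kills the term `x = 0`, leaving a character sum over `kˣ`.
  rw [sum_eq_sum_units _ (by simp)]
  let χ : kˣ →* F :=
    { toFun := fun x => (κ x)⁻¹ * embProd j (x : k)
      map_one' := by simp [embProd_one]
      map_mul' := fun x y => by simp [embProd_mul]; ring }
  have h := sum_unitsHom p χ
  have hiff : χ = 1 ↔ j = Pi.single κ 1 := by
    have h1 : ∀ ν, (Pi.single κ 1 : (k →+* F) → ℕ) ν ≤ p - 2 := fun ν => by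
      rw [Pi.single_apply]; split_ifs <;> omega
    constructor
    · intro hχ
      refine eq_of_embProd_eq p hp2 hj h1 fun x hx => ?_
      have := DFunLike.congr_fun hχ (Units.mk0 x hx)
      change (κ x)⁻¹ * embProd j x = 1 at this
      rw [embProd_single, pow_one, ← mul_one (κ x), ← this,
        mul_inv_cancel_left₀ ((map_ne_zero κ).2 hx)]
    · rintro rfl
      ext x
      change (κ x)⁻¹ * embProd (Pi.single κ 1) (x : k) = 1
      rw [embProd_single, pow_one, inv_mul_cancel₀ ((map_ne_zero κ).2 x.ne_zero)]
  change ∑ x, χ x = _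
  rw [h]
  simp only [hiff]

/-- Consequently `∑ κ(x)⁻¹ u(x)` kills every vector fixed by the unipotents `u(x)`. For `k = 𝔽₂` the
sum would be `1`. -/
theorem sum_inv_eq_zero (hp2 : 2 < p) (κ : k →+* F) : ∑ x : k, (κ x)⁻¹ = 0 := by
  classical
  have := sum_inv_mul_embProd p hp2 κ (j := 0) (by simp)
  simp only [embProd_zero, mul_one] at this
  rw [this, if_neg]
  intro h
  have := congrFun h κ
  simp at this

theorem sum_inv_mul_apply [DecidableEq (k →+* F)] (hp2 : 2 < p) (κ ν : k →+* F) :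
    ∑ x : k, (κ x)⁻¹ * ν x = if ν = κ then -1 else 0 := by
  have := sum_inv_mul_embProd p hp2 κ (j := Pi.single ν 1) fun μ => by
    rw [Pi.single_apply]; split_ifs <;> omega
  simp only [embProd_single, pow_one] at this
  rw [this]
  congr 1
  refine propext ⟨fun h => ?_, fun h => by rw [h]⟩
  by_contra hne
  have := congrFun h ν
  simp [hne] at this

/-- An additive map on `k` all of whose `κ`-semilinear components vanish is zero. -/
theorem eq_zero_of_forall_sum_inv_smul_eq_zero (hp2 : 2 < p) {M : Type*} [AddCommGroup M]
    [Module F M] (φ : k →+ M) (h : ∀ κ : k →+* F, ∑ x : k, (κ x)⁻¹ • φ x = 0) : φ = 0 := by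
  classical
  let _ := ZMod.algebra k p
  let _ := ZMod.algebra F p
  -- For values in `F`: the embeddings are independent by Dedekind and have the right number, so
  -- they form a basis of `Hom(k, F)`. Orthogonality makes the sums equal to the coordinates, up to
  -- sign.
  have key : ∀ ψ : k →ₗ[ZMod p] F, (∀ κ : k →+* F, ∑ x : k, (κ x)⁻¹ * ψ x = 0) → ψ = 0 := by
    intro ψ hψ
    have hli := (linearIndependent_algHom_toLinearMap (ZMod p) k F)
      |>.comp _ (ringHomEquivAlgHom p k F).injective
    have hfr : Fintype.card (k →+* F) = Module.finrank F (k →ₗ[ZMod p] F) := by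
      rw [card_ringHom_eq_finrank p, Module.finrank_linearMap_self]
    have hne : Nonempty (k →+* F) := by
      obtain ⟨_, κ₀, -⟩ := exists_equiv_embeddings p (k := k) (F := F); exact ⟨κ₀⟩
    let B := basisOfLinearIndependentOfCardEqFinrank hli hfr
    have hψs := B.sum_repr ψ
    have hB : ∀ ν x, B ν x = ν x := fun ν x => by
      simp only [B, coe_basisOfLinearIndependentOfCardEqFinrank]; rfl
    have hc : ∀ κ, B.repr ψ κ = 0 := by
      intro κ
      have h1 := hψ κ
      rw [← hψs] at h1
      simp only [LinearMap.sum_apply, LinearMap.smul_apply, hB, smul_eq_mul, Finset.mul_sum] at h1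
      rw [Finset.sum_comm] at h1
      have h2 : ∀ ν, ∑ x : k, (κ x)⁻¹ * (B.repr ψ ν * ν x) =
          B.repr ψ ν * if ν = κ then -1 else 0 := fun ν => by
        rw [← sum_inv_mul_apply p hp2, Finset.mul_sum]
        exact Finset.sum_congr rfl fun x _ => by ring
      simpa [h2] using h1
    rw [← hψs]
    simp [hc]
  ext x
  -- Linear functionals separate points of `M`, which reduces to values in `F`.
  rw [AddMonoidHom.zero_apply, ← Module.forall_dual_apply_eq_zero_iff F]
  intro l
  have := key ((l.toAddMonoidHom.comp φ).toZModLinearMap p) fun κ => by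
    simpa using congrArg l (h κ)
  exact LinearMap.congr_fun this x

end

end FiniteFieldCharacters

/-! ### Elements of `GL₂` -/

section Elements

variable {R : Type*} [CommRing R]

/-- The upper unipotent matrix with entry `x`. -/
def upperUnip (x : R) : GL (Fin 2) R where
  val := !![1, x; 0, 1]
  inv := !![1, -x; 0, 1]
  val_inv := by ext i j; fin_cases i <;> fin_cases j <;> simp
  inv_val := by ext i j; fin_cases i <;> fin_cases j <;> simp

/-- The lower unipotent matrix with entry `x`. -/
def lowerUnip (x : R) : GL (Fin 2) R where
  val := !![1, 0; x, 1]
  inv := !![1, 0; -x, 1]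
  val_inv := by ext i j; fin_cases i <;> fin_cases j <;> simp
  inv_val := by ext i j; fin_cases i <;> fin_cases j <;> simp

/-- The diagonal matrix with entries `a`, `d`. -/
def diagGL (a d : Rˣ) : GL (Fin 2) R where
  val := !![(a : R), 0; 0, d]
  inv := !![((a⁻¹ : Rˣ) : R), 0; 0, ((d⁻¹ : Rˣ) : R)]
  val_inv := by ext i j; fin_cases i <;> fin_cases j <;> simp
  inv_val := by ext i j; fin_cases i <;> fin_cases j <;> simp

/-- The permutation matrix of the non-trivial permutation. -/
def swapGL (R : Type*) [CommRing R] : GL (Fin 2) R where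
  val := !![0, 1; 1, 0]
  inv := !![0, 1; 1, 0]
  val_inv := by ext i j; fin_cases i <;> fin_cases j <;> simp
  inv_val := by ext i j; fin_cases i <;> fin_cases j <;> simp

variable {S : Type*} [CommRing S] (φ : R →+* S)

theorem map_upperUnip (x : R) :
    Matrix.GeneralLinearGroup.map φ (upperUnip x) = upperUnip (φ x) := by
  ext i j; fin_cases i <;> fin_cases j <;> simp [upperUnip]

theorem map_lowerUnip (x : R) :
    Matrix.GeneralLinearGroup.map φ (lowerUnip x) = lowerUnip (φ x) := by
  ext i j; fin_cases i <;> fin_cases j <;> simp [lowerUnip]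

theorem map_diagGL (a d : Rˣ) :
    Matrix.GeneralLinearGroup.map φ (diagGL a d) =
      diagGL (Units.map (φ : R →* S) a) (Units.map (φ : R →* S) d) := by
  ext i j; fin_cases i <;> fin_cases j <;> simp [diagGL]

theorem upperUnip_mul (x y : R) : upperUnip x * upperUnip y = upperUnip (x + y) := by
  ext i j; fin_cases i <;> fin_cases j <;> simp [upperUnip, add_comm]

theorem upperUnip_zero : upperUnip (0 : R) = 1 := by
  ext i j; fin_cases i <;> fin_cases j <;> simp [upperUnip]

theorem upperUnip_pow (x : R) (n : ℕ) : upperUnip x ^ n = upperUnip (n * x) := by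
  induction n with
  | zero => simp [upperUnip_zero]
  | succ n ih => rw [pow_succ, ih, upperUnip_mul]; congr 1; push_cast; ring

theorem det_upperUnip (x : R) : Matrix.GeneralLinearGroup.det (upperUnip x) = 1 := by
  ext; simp [upperUnip]

theorem det_lowerUnip (x : R) : Matrix.GeneralLinearGroup.det (lowerUnip x) = 1 := by
  ext; simp [lowerUnip]

theorem det_diagGL (a d : Rˣ) : Matrix.GeneralLinearGroup.det (diagGL a d) = a * d := by
  ext; simp [diagGL]

end Elements

/-! ### The monomial basis of a symmetric power -/

section SymmetricPower

variable {F : Type u} [Field F]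

/-- The monomial `X₀^i X₁^(s-i)` in `Sym^s F²` (zero for `i > s`). -/
noncomputable def symMonomial (s i : ℕ) : MvPolynomial.homogeneousSubmodule (Fin 2) F s :=
  if h : i ≤ s then ⟨MvPolynomial.X 0 ^ i * MvPolynomial.X 1 ^ (s - i), by
    have := ((MvPolynomial.isHomogeneous_X F (0 : Fin 2)).pow i).mul
      ((MvPolynomial.isHomogeneous_X F (1 : Fin 2)).pow (s - i))
    rw [MvPolynomial.mem_homogeneousSubmodule]
    rwa [one_mul, one_mul, Nat.add_sub_cancel' h] at this⟩ else 0

theorem coe_symMonomial {s i : ℕ} (h : i ≤ s) :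
    (symMonomial (F := F) s i : MvPolynomial (Fin 2) F) =
      MvPolynomial.X 0 ^ i * MvPolynomial.X 1 ^ (s - i) := by
  rw [symMonomial, dif_pos h]

theorem symMonomial_of_lt {s i : ℕ} (h : s < i) : symMonomial (F := F) s i = 0 := by
  rw [symMonomial, dif_neg (by omega)]

theorem X_pow_mul_X_pow (i j : ℕ) :
    (MvPolynomial.X 0 ^ i * MvPolynomial.X 1 ^ j : MvPolynomial (Fin 2) F) =
      MvPolynomial.monomial (Finsupp.single 0 i + Finsupp.single 1 j) 1 := by
  rw [MvPolynomial.X_pow_eq_monomial, MvPolynomial.X_pow_eq_monomial, MvPolynomial.monomial_mul,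
    one_mul]

theorem linearIndependent_symMonomial (s : ℕ) :
    LinearIndependent F fun i : Fin (s + 1) => symMonomial (F := F) s i := by
  apply LinearIndependent.of_comp (MvPolynomial.homogeneousSubmodule (Fin 2) F s).subtype
  have h := (MvPolynomial.basisMonomials (Fin 2) F).linearIndependent.comp
    (fun i : Fin (s + 1) => Finsupp.single 0 (i : ℕ) + Finsupp.single 1 (s - i : ℕ)) (by
      intro i j h
      have := DFunLike.congr_fun h 0
      simpa [Fin.ext_iff] using this)
  convert h using 1
  funext i
  simp only [Function.comp_apply, Submodule.subtype_apply, MvPolynomial.coe_basisMonomials]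
  rw [coe_symMonomial (Nat.lt_succ_iff.1 i.2), X_pow_mul_X_pow]

theorem span_symMonomial (s : ℕ) :
    ⊤ ≤ Submodule.span F (Set.range fun i : Fin (s + 1) => symMonomial (F := F) s i) := by
  rintro ⟨P, hP⟩ -
  rw [MvPolynomial.mem_homogeneousSubmodule] at hP
  have hmem : P ∈ (Submodule.span F (Set.range fun i : Fin (s + 1) =>
      symMonomial (F := F) s i)).map (MvPolynomial.homogeneousSubmodule (Fin 2) F s).subtype := by
    rw [P.as_sum]
    refine Submodule.sum_mem _ fun d hd => ?_
    have hdeg : d 0 + d 1 = s := by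
      have := hP (MvPolynomial.mem_support_iff.1 hd)
      rw [Finsupp.weight_apply, Finsupp.sum_fintype _ _ (by simp)] at this
      simpa using this
    refine ⟨P.coeff d • symMonomial s (d 0), Submodule.smul_mem _ _
      (Submodule.subset_span ⟨⟨d 0, by omega⟩, rfl⟩), ?_⟩
    rw [Submodule.subtype_apply, Submodule.coe_smul, coe_symMonomial (by omega), X_pow_mul_X_pow,
      MvPolynomial.smul_monomial, smul_eq_mul, mul_one]
    have hd' : Finsupp.single 0 (d 0) + Finsupp.single 1 (s - d 0) = d := by
      refine Finsupp.ext fun n => ?_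
      fin_cases n
      · simp
      · simp; omega
    rw [hd']
  obtain ⟨Q, hQ, hQP⟩ := hmem
  have : Q = ⟨P, hP⟩ := Subtype.ext hQP
  rwa [← this]

/-- The monomial basis of `Sym^s F²`. -/
noncomputable def symBasis (F : Type u) [Field F] (s : ℕ) :
    Module.Basis (Fin (s + 1)) F (MvPolynomial.homogeneousSubmodule (Fin 2) F s) :=
  Module.Basis.mk (linearIndependent_symMonomial s) (span_symMonomial s)

theorem symBasis_apply (s : ℕ) (i : Fin (s + 1)) : symBasis F s i = symMonomial s i := by
  simp [symBasis]

theorem coe_symRep (s : ℕ) (g : GL (Fin 2) F)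
    (P : MvPolynomial.homogeneousSubmodule (Fin 2) F s) :
    (symRep s g P : MvPolynomial (Fin 2) F) =
      symAlgHom (g : Matrix (Fin 2) (Fin 2) F) (P : MvPolynomial (Fin 2) F) := rfl

/-- Binomial expansion. The summation bound `n` is left free so that all tensor factors can share
one range; the extra terms have zero binomial coefficient. -/
theorem symRep_upperUnip (x : F) {s i n : ℕ} (hn : s < n) :
    symRep s (upperUnip x) (symMonomial s i) =
      ∑ j ∈ Finset.range n, (((s - i).choose j : F) * x ^ j) • symMonomial s (i + j) := by
  rcases lt_or_ge s i with hi | hi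
  · rw [symMonomial_of_lt hi, map_zero, Finset.sum_eq_zero]
    intro j _
    rw [symMonomial_of_lt (by omega), smul_zero]
  have hsub : Finset.range (s - i + 1) ⊆ Finset.range n := by
    intro a ha; simp only [Finset.mem_range] at *; omega
  rw [← Finset.sum_subset hsub fun j _ hj => by
    rw [Nat.choose_eq_zero_of_lt (by simpa using hj)]; simp]
  apply Subtype.ext
  rw [AddSubmonoidClass.coe_finsetSum]
  rw [coe_symRep, coe_symMonomial hi, map_mul, map_pow, map_pow, symAlgHom_X, symAlgHom_X]
  simp only [upperUnip, Fin.sum_univ_two, Matrix.of_apply, Matrix.cons_val', Matrix.cons_val_zero,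
    Matrix.cons_val_one, Matrix.cons_val_fin_one, map_zero, zero_mul, add_zero, map_one, one_mul]
  rw [add_pow, Finset.mul_sum]
  refine Finset.sum_congr rfl fun j hj => ?_
  have hj' : j ≤ s - i := by simpa [Nat.lt_succ_iff] using hj
  rw [Submodule.coe_smul, coe_symMonomial (by omega), Nat.sub_sub, MvPolynomial.smul_eq_C_mul,
    map_mul, map_pow, map_natCast]
  ring

/-- Here `i ≤ s` is needed: for `i > s` the left side is zero by convention, while terms with `i - j
≤ s` on the right need not vanish. -/
theorem symRep_lowerUnip (x : F) {s i n : ℕ} (hi : i ≤ s) (hn : s < n) :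
    symRep s (lowerUnip x) (symMonomial s i) =
      ∑ j ∈ Finset.range n, ((i.choose j : F) * x ^ j) • symMonomial s (i - j) := by
  have hsub : Finset.range (i + 1) ⊆ Finset.range n := by
    intro a ha; simp only [Finset.mem_range] at *; omega
  rw [← Finset.sum_subset hsub fun j _ hj => by
    rw [Nat.choose_eq_zero_of_lt (by simpa using hj)]; simp]
  apply Subtype.ext
  rw [AddSubmonoidClass.coe_finsetSum]
  rw [coe_symRep, coe_symMonomial hi, map_mul, map_pow, map_pow, symAlgHom_X, symAlgHom_X]
  simp only [lowerUnip, Fin.sum_univ_two, Matrix.of_apply, Matrix.cons_val', Matrix.cons_val_zero,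
    Matrix.cons_val_one, Matrix.cons_val_fin_one, map_zero, zero_mul, zero_add, map_one, one_mul]
  rw [add_comm, add_pow, Finset.sum_mul]
  refine Finset.sum_congr rfl fun j hj => ?_
  have hj' : j ≤ i := by simpa [Nat.lt_succ_iff] using hj
  rw [Submodule.coe_smul, coe_symMonomial (by omega), MvPolynomial.smul_eq_C_mul,
    map_mul, map_pow, map_natCast, show s - (i - j) = (s - i) + j by omega]
  ring

theorem symRep_diagGL (a d : Fˣ) {s i : ℕ} :
    symRep s (diagGL a d) (symMonomial s i) =
      ((a : F) ^ i * (d : F) ^ (s - i)) • symMonomial s i := by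
  rcases lt_or_ge s i with hi | hi
  · rw [symMonomial_of_lt hi, map_zero, smul_zero]
  apply Subtype.ext
  rw [coe_symRep, Submodule.coe_smul, coe_symMonomial hi, map_mul, map_pow, map_pow, symAlgHom_X, symAlgHom_X]
  simp only [diagGL, Fin.sum_univ_two, Matrix.of_apply, Matrix.cons_val', Matrix.cons_val_zero,
    Matrix.cons_val_one, Matrix.cons_val_fin_one, map_zero, zero_mul, zero_add, add_zero]
  rw [MvPolynomial.smul_eq_C_mul, map_mul, map_pow, map_pow]
  ring

end SymmetricPower

/-! ### The action of unipotent and diagonal elements on a Serre weight -/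

section SerreWeightFormulas

variable (p : ℕ) [Fact p.Prime] {k F : Type u} [Field k] [Fintype k] [CharP k p] [Field F]
  [CharP F p] [IsAlgClosed F] [Fintype (k →+* F)]

/-- The universal multilinear map into the space of a Serre weight. -/
noncomputable def serreTprod (s : (k →+* F) → ℕ) :
    MultilinearMap F (fun κ : k →+* F => MvPolynomial.homogeneousSubmodule (Fin 2) F (s κ))
      (SerreSpace F k s) :=
  PiTensorProduct.tprod F

/-- The vector `⨂_κ X₀^{i_κ} X₁^{s_κ - i_κ}` of the Serre weight (zero unless `i ≤ s`). -/
noncomputable def serreVec (s i : (k →+* F) → ℕ) : SerreSpace F k s :=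
  serreTprod s fun κ => symMonomial (s κ) (i κ)

theorem serreVec_of_lt {s i : (k →+* F) → ℕ} {κ : k →+* F} (h : s κ < i κ) :
    serreVec s i = 0 :=
  (serreTprod s).map_coord_zero κ (symMonomial_of_lt h)

/-- The basis of a Serre weight consisting of tensor products of monomials. -/
noncomputable def serreBasis (s : (k →+* F) → ℕ) :
    Module.Basis (∀ κ, Fin (s κ + 1)) F (SerreSpace F k s) :=
  Basis.piTensorProduct fun κ => symBasis F (s κ)

theorem serreBasis_apply (s : (k →+* F) → ℕ) (i : ∀ κ, Fin (s κ + 1)) :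
    serreBasis s i = serreVec s fun κ => i κ := by
  refine (Basis.piTensorProduct_apply _ _).trans ?_
  simp only [symBasis_apply]
  rfl

/-- The character `u ↦ ∏_κ κ(u)^{t_κ}` of `kˣ`. -/
def detChar (t : (k →+* F) → ℤ) (u : kˣ) : F :=
  ∏ κ : k →+* F, (((Units.map (κ : k →* F) u) ^ t κ : Fˣ) : F)

theorem detChar_ne_zero (t : (k →+* F) → ℤ) (u : kˣ) : detChar t u ≠ 0 :=
  Finset.prod_ne_zero_iff.2 fun _ _ => Units.ne_zero _

theorem detChar_one (t : (k →+* F) → ℤ) : detChar t 1 = 1 := by simp [detChar]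

theorem serreWeight_tprod (t : (k →+* F) → ℤ) (s : (k →+* F) → ℕ) (g : GL (Fin 2) k)
    (v : ∀ κ, MvPolynomial.homogeneousSubmodule (Fin 2) F (s κ)) :
    serreWeight t s g (serreTprod s v) =
      detChar t (Matrix.GeneralLinearGroup.det g) • serreTprod s fun κ =>
        symRep (s κ) (Matrix.GeneralLinearGroup.map κ g) (v κ) := by
  have h : serreWeight t s g (serreTprod s v) =
      (serreTprod s fun κ =>
        detSymRep (t κ) (s κ) (Matrix.GeneralLinearGroup.map κ g) (v κ)) :=
    PiTensorProduct.map_tprod _ _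
  have h2 : ∀ κ : k →+* F, detSymRep (t κ) (s κ) (Matrix.GeneralLinearGroup.map κ g) (v κ) =
      (((Units.map (κ : k →* F) (Matrix.GeneralLinearGroup.det g)) ^ t κ : Fˣ) : F) •
        symRep (s κ) (Matrix.GeneralLinearGroup.map κ g) (v κ) := by
    intro κ
    have h3 : Matrix.GeneralLinearGroup.det (Matrix.GeneralLinearGroup.map κ g) =
        Units.map (κ : k →* F) (Matrix.GeneralLinearGroup.det g) :=
      Matrix.GeneralLinearGroup.map_det κ g
    rw [← h3]
    rfl
  rw [h, funext h2]
  exact (serreTprod s).map_smul_univ _ _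

theorem serreWeight_diagGL (t : (k →+* F) → ℤ) (s i : (k →+* F) → ℕ) (a d : kˣ) :
    serreWeight t s (diagGL a d) (serreVec s i) =
      (detChar t (a * d) * (embProd i (a : k) * embProd (s - i) (d : k))) • serreVec s i := by
  rw [serreVec, serreWeight_tprod, det_diagGL, mul_smul]
  congr 1
  simp only [map_diagGL, symRep_diagGL]
  refine ((serreTprod s).map_smul_univ _ _).trans ?_
  rw [Finset.prod_mul_distrib]
  rfl

theorem serreWeight_upperUnip (t : (k →+* F) → ℤ) {s : (k →+* F) → ℕ} (i : (k →+* F) → ℕ) {n : ℕ}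
    [DecidableEq (k →+* F)] (hn : ∀ κ, s κ < n) (x : k) :
    serreWeight t s (upperUnip x) (serreVec s i) =
      ∑ j ∈ Fintype.piFinset fun _ : k →+* F => Finset.range n,
        ((∏ κ, ((s κ - i κ).choose (j κ) : F)) * embProd j x) • serreVec s (i + j) := by
  rw [serreVec, serreWeight_tprod, det_upperUnip, detChar_one, one_smul]
  simp only [map_upperUnip, fun κ : k →+* F => symRep_upperUnip (κ x) (i := i κ) (hn κ)]
  refine ((serreTprod s).map_sum_finset _ _).trans (Finset.sum_congr rfl fun j _ => ?_)
  refine ((serreTprod s).map_smul_univ _ _).trans ?_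
  rw [Finset.prod_mul_distrib]
  rfl

theorem serreWeight_lowerUnip (t : (k →+* F) → ℤ) {s i : (k →+* F) → ℕ} {n : ℕ}
    [DecidableEq (k →+* F)] (hi : i ≤ s) (hn : ∀ κ, s κ < n) (x : k) :
    serreWeight t s (lowerUnip x) (serreVec s i) =
      ∑ j ∈ Fintype.piFinset fun _ : k →+* F => Finset.range n,
        ((∏ κ, ((i κ).choose (j κ) : F)) * embProd j x) • serreVec s (i - j) := by
  rw [serreVec, serreWeight_tprod, det_lowerUnip, detChar_one, one_smul]
  simp only [map_lowerUnip, fun κ : k →+* F => symRep_lowerUnip (κ x) (hi κ) (hn κ)]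
  refine ((serreTprod s).map_sum_finset _ _).trans (Finset.sum_congr rfl fun j _ => ?_)
  refine ((serreTprod s).map_smul_univ _ _).trans ?_
  rw [Finset.prod_mul_distrib]
  rfl

theorem serreWeight_lowerUnip_zero (t : (k →+* F) → ℤ) (s : (k →+* F) → ℕ) (x : k) :
    serreWeight t s (lowerUnip x) (serreVec s 0) = serreVec s 0 := by
  rw [serreVec, serreWeight_tprod, det_lowerUnip, detChar_one, one_smul]
  congr 1
  funext κ
  rw [map_lowerUnip, Pi.zero_apply, symRep_lowerUnip _ (Nat.zero_le _) (Nat.lt_succ_self _),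
    Finset.sum_range_succ', Finset.sum_eq_zero fun j _ => by simp]
  simp

/-- Orthogonality of characters keeps only the linear term `j = Pi.single κ 1`. The range `p - 1`
keeps all digits at most `p - 2`, where characters determine exponents; this is what weak regularity
provides. -/
theorem sum_choose_smul [DecidableEq (k →+* F)] (hp2 : 2 < p) (κ : k →+* F) {M : Type*}
    [AddCommGroup M] [Module F M] (c : (k →+* F) → ℕ) (v : ((k →+* F) → ℕ) → M) :
    ∑ x : k, (κ x)⁻¹ • ∑ j ∈ Fintype.piFinset fun _ : k →+* F => Finset.range (p - 1),
      ((∏ ν, ((c ν).choose (j ν) : F)) * embProd j x) • v j = -(c κ : F) • v (Pi.single κ 1) := by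
  simp only [Finset.smul_sum, smul_smul]
  rw [Finset.sum_comm]
  have h : ∀ j ∈ Fintype.piFinset fun _ : k →+* F => Finset.range (p - 1),
      ∑ x : k, ((κ x)⁻¹ * ((∏ ν, ((c ν).choose (j ν) : F)) * embProd j x)) • v j =
      if j = Pi.single κ 1 then -(c κ : F) • v (Pi.single κ 1) else 0 := by
    intro j hj
    rw [← Finset.sum_smul]
    have h1 := sum_inv_mul_embProd p hp2 κ (j := j) fun ν => by
      have := Fintype.mem_piFinset.1 hj ν
      rw [Finset.mem_range] at this
      omega
    have h2 : ∑ x : k, ((κ x)⁻¹ * ((∏ ν, ((c ν).choose (j ν) : F)) * embProd j x)) =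
        (∏ ν, ((c ν).choose (j ν) : F)) * ∑ x : k, (κ x)⁻¹ * embProd j x := by
      rw [Finset.mul_sum]
      exact Finset.sum_congr rfl fun x _ => by ring
    rw [h2, h1]
    split_ifs with hjs
    · subst hjs
      rw [Finset.prod_eq_single κ]
      · simp
      · intro ν _ hν; simp [hν]
      · simp
    · simp
  rw [Finset.sum_congr rfl h, Finset.sum_ite_eq', if_pos]
  rw [Fintype.mem_piFinset]
  intro ν
  rw [Finset.mem_range, Pi.single_apply]
  split_ifs <;> omega

/-- The raising operator `∑_x κ(x)⁻¹ u(x)` attached to an embedding. -/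
theorem sum_upperUnip_serreVec [DecidableEq (k →+* F)] (hp2 : 2 < p) (t : (k →+* F) → ℤ)
    {s : (k →+* F) → ℕ} (hs : ∀ κ, s κ ≤ p - 2) (κ : k →+* F) (i : (k →+* F) → ℕ) :
    ∑ x : k, (κ x)⁻¹ • serreWeight t s (upperUnip x) (serreVec s i) =
      -((s κ - i κ : ℕ) : F) • serreVec s (i + Pi.single κ 1) := by
  simp only [serreWeight_upperUnip t i (n := p - 1) fun κ => (hs κ).trans_lt (by omega)]
  exact sum_choose_smul p hp2 κ (fun ν => s ν - i ν) fun j => serreVec s (i + j)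

/-- The lowering operator attached to an embedding. -/
theorem sum_lowerUnip_serreVec [DecidableEq (k →+* F)] (hp2 : 2 < p) (t : (k →+* F) → ℤ)
    {s : (k →+* F) → ℕ} (hs : ∀ κ, s κ ≤ p - 2) (κ : k →+* F) {i : (k →+* F) → ℕ} (hi : i ≤ s) :
    ∑ x : k, (κ x)⁻¹ • serreWeight t s (lowerUnip x) (serreVec s i) =
      -(i κ : F) • serreVec s (i - Pi.single κ 1) := by
  simp only [serreWeight_lowerUnip t hi (n := p - 1) fun κ => (hs κ).trans_lt (by omega)]
  exact sum_choose_smul p hp2 κ i fun j => serreVec s (i - j)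

theorem serreWeight_congr_det {t t' : (k →+* F) → ℤ} (s : (k →+* F) → ℕ)
    (h : ∀ u : kˣ, detChar t u = detChar t' u) : serreWeight t s = serreWeight t' s := by
  ext1 g
  refine PiTensorProduct.ext (MultilinearMap.ext fun v => ?_)
  exact (serreWeight_tprod t s g v).trans ((h _).symm ▸ (serreWeight_tprod t' s g v).symm)

/-- The character through which diagonal matrices act on the lowest weight vector. -/
def lowestWeight (t : (k →+* F) → ℤ) (s : (k →+* F) → ℕ) (a d : kˣ) : F :=
  detChar t (a * d) * embProd s (d : k)

theorem lowestWeight_ne_zero (t : (k →+* F) → ℤ) (s : (k →+* F) → ℕ) (a d : kˣ) :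
    lowestWeight t s a d ≠ 0 :=
  mul_ne_zero (detChar_ne_zero _ _) (embProd_ne_zero _ d.ne_zero)

theorem serreWeight_diagGL_zero (t : (k →+* F) → ℤ) (s : (k →+* F) → ℕ) (a d : kˣ) :
    serreWeight t s (diagGL a d) (serreVec s 0) = lowestWeight t s a d • serreVec s 0 := by
  rw [serreWeight_diagGL, embProd_zero, one_mul, lowestWeight]
  rfl

/-- A weakly regular Serre weight is determined by its lowest weight. -/
theorem nonempty_equiv_of_lowestWeight_eq (hp2 : 2 < p) {t t' : (k →+* F) → ℤ}
    {s s' : (k →+* F) → ℕ} (hs : ∀ κ, s κ ≤ p - 2) (hs' : ∀ κ, s' κ ≤ p - 2)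
    (h : ∀ a d : kˣ, lowestWeight t s a d = lowestWeight t' s' a d) :
    Nonempty ((serreWeight t s).Equiv (serreWeight t' s')) := by
  -- The elements `diag(x⁻¹, x)` have determinant `1` and isolate `s`; afterwards `diag(u, 1)`
  -- isolates the power of the determinant.
  obtain rfl : s = s' := eq_of_embProd_eq p hp2 hs hs' fun x hx => by
    simpa [lowestWeight, detChar_one] using h (Units.mk0 x hx)⁻¹ (Units.mk0 x hx)
  have hd : ∀ u : kˣ, detChar t u = detChar t' u := fun u => by
    simpa [lowestWeight, embProd_one] using h u 1
  rw [serreWeight_congr_det s hd]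
  exact ⟨.refl _⟩

end SerreWeightFormulas

/-! ### Coordinates, highest weight theory -/

section SerreWeightStructure

variable (p : ℕ) [Fact p.Prime] {k F : Type u} [Field k] [Fintype k] [CharP k p] [Field F]
  [CharP F p] [IsAlgClosed F] [Fintype (k →+* F)]

theorem single_one_le {ι : Type*} [DecidableEq ι] {i : ι → ℕ} {κ : ι} (h : i κ ≠ 0) :
    Pi.single κ 1 ≤ i := by
  intro ν
  by_cases hν : ν = κ
  · subst hν
    rw [Pi.single_eq_same]
    exact Nat.one_le_iff_ne_zero.2 h
  · rw [Pi.single_eq_of_ne hν]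
    exact Nat.zero_le _

theorem serreSpace_hom_ext {s : (k →+* F) → ℕ} {M : Type*} [AddCommGroup M] [Module F M]
    {φ ψ : SerreSpace F k s →ₗ[F] M} (h : ∀ i ≤ s, φ (serreVec s i) = ψ (serreVec s i)) :
    φ = ψ := by
  refine (serreBasis s).ext fun i => ?_
  rw [serreBasis_apply]
  exact h _ fun κ => Nat.lt_succ_iff.1 (i κ).2

/-- The coordinate functional dual to `serreVec s i` (zero unless `i ≤ s`). -/
noncomputable def serreCoord (s i : (k →+* F) → ℕ) : SerreSpace F k s →ₗ[F] F :=
  open scoped Classical in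
  if h : ∀ κ, i κ < s κ + 1 then (serreBasis s).coord fun κ => ⟨i κ, h κ⟩ else 0

theorem serreCoord_serreVec [DecidableEq (k →+* F)] {s i j : (k →+* F) → ℕ} (hi : i ≤ s)
    (hj : j ≤ s) : serreCoord s i (serreVec s j) = if i = j then 1 else 0 := by
  have hi' : ∀ κ, i κ < s κ + 1 := fun κ => Nat.lt_succ_of_le (hi κ)
  have hj' : ∀ κ, j κ < s κ + 1 := fun κ => Nat.lt_succ_of_le (hj κ)
  rw [serreCoord, dif_pos hi', ← serreBasis_apply s fun κ => ⟨j κ, hj' κ⟩, Module.Basis.coord_apply,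
    Module.Basis.repr_self, Finsupp.single_apply]
  congr 1
  rw [eq_iff_iff, eq_comm]
  simp [funext_iff]

theorem serreCoord_of_not_le {s i : (k →+* F) → ℕ} (hi : ¬ i ≤ s) : serreCoord s i = 0 := by
  rw [serreCoord, dif_neg]
  intro h
  exact hi fun κ => Nat.lt_succ_iff.1 (h κ)

theorem eq_of_serreCoord_eq {s : (k →+* F) → ℕ} {v w : SerreSpace F k s}
    (h : ∀ i ≤ s, serreCoord s i v = serreCoord s i w) : v = w := by
  refine (serreBasis s).ext_elem fun i => ?_
  have := h (fun κ => i κ) fun κ => Nat.lt_succ_iff.1 (i κ).2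
  rwa [serreCoord, dif_pos fun κ => (i κ).2] at this

/-- The raising operator `∑_x κ(x)⁻¹ u(x)`. -/
noncomputable def raising (t : (k →+* F) → ℤ) (s : (k →+* F) → ℕ) (κ : k →+* F) :
    Module.End F (SerreSpace F k s) :=
  ∑ x : k, (κ x)⁻¹ • serreWeight t s (upperUnip x)

/-- The lowering operator `∑_x κ(x)⁻¹ u⁻(x)`. -/
noncomputable def lowering (t : (k →+* F) → ℤ) (s : (k →+* F) → ℕ) (κ : k →+* F) :
    Module.End F (SerreSpace F k s) :=
  ∑ x : k, (κ x)⁻¹ • serreWeight t s (lowerUnip x)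

section

variable [DecidableEq (k →+* F)] (hp2 : 2 < p) (t : (k →+* F) → ℤ) {s : (k →+* F) → ℕ}
  (hs : ∀ κ, s κ ≤ p - 2)

include hp2 hs

theorem raising_serreVec (κ : k →+* F) (i : (k →+* F) → ℕ) :
    raising t s κ (serreVec s i) = -((s κ - i κ : ℕ) : F) • serreVec s (i + Pi.single κ 1) := by
  rw [← sum_upperUnip_serreVec p hp2 t hs κ i]
  simp [raising]

theorem lowering_serreVec (κ : k →+* F) {i : (k →+* F) → ℕ} (hi : i ≤ s) :
    lowering t s κ (serreVec s i) = -(i κ : F) • serreVec s (i - Pi.single κ 1) := by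
  rw [← sum_lowerUnip_serreVec p hp2 t hs κ hi]
  simp [lowering]

theorem exists_raising_pow_serreVec_zero (κ : k →+* F) (n : ℕ) :
    ∃ c : F, (raising t s κ ^ n) (serreVec s 0) = c • serreVec s (Pi.single κ n) := by
  induction n with
  | zero => exact ⟨1, by simp⟩
  | succ n ih =>
    obtain ⟨c, hc⟩ := ih
    refine ⟨c * -((s κ - (Pi.single κ n : (k →+* F) → ℕ) κ : ℕ) : F), ?_⟩
    rw [pow_succ', Module.End.mul_apply, hc, map_smul, raising_serreVec p hp2 t hs, ← Pi.single_add,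
      smul_smul]

theorem raising_pow_serreVec_zero (κ : k →+* F) :
    (raising t s κ ^ (s κ + 1)) (serreVec s 0) = 0 := by
  obtain ⟨c, hc⟩ := exists_raising_pow_serreVec_zero p hp2 t hs κ (s κ + 1)
  rw [hc, serreVec_of_lt (κ := κ) (by simp), smul_zero]

/-- The transpose of the raising operator shifts a coordinate functional down by one at `κ`. Only
this support information is used later, so the scalar is left unspecified. -/
theorem serreCoord_raising (κ : k →+* F) {i : (k →+* F) → ℕ} :
    ∃ c : F, serreCoord s i ∘ₗ raising t s κ =
      if i κ = 0 then 0 else c • serreCoord s (i - Pi.single κ 1) := by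
  by_cases hi : i ≤ s
  swap
  · exact ⟨0, by rw [serreCoord_of_not_le hi]; simp⟩
  refine ⟨-((s κ - (i κ - 1) : ℕ) : F), serreSpace_hom_ext fun j hj => ?_⟩
  rw [LinearMap.comp_apply, raising_serreVec p hp2 t hs, map_smul, smul_eq_mul]
  rcases lt_or_ge (s κ) (j κ + 1) with hlt | hle
  · have h0 : s κ - j κ = 0 := by omega
    rw [h0, Nat.cast_zero, neg_zero, zero_mul]
    split_ifs with hik
    · rfl
    have hle : i - Pi.single κ 1 ≤ s := fun ν =>
      (Nat.sub_le _ _).trans (hi ν)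
    rw [LinearMap.smul_apply, serreCoord_serreVec hle hj, if_neg, smul_zero]
    intro h
    have h1 := congrFun h κ
    have h2 : i κ ≤ s κ := hi κ
    rw [Pi.sub_apply, Pi.single_eq_same] at h1
    omega
  · have hj1 : j + Pi.single κ 1 ≤ s := fun ν => by
      rw [Pi.add_apply, Pi.single_apply]
      split_ifs with h
      · rw [h]; exact hle
      · exact hj ν
    rw [serreCoord_serreVec hi hj1]
    split_ifs with h1 h2 h2
    · simp [h1] at h2
    · have hij : i - Pi.single κ 1 = j := by rw [h1]; exact add_tsub_cancel_right _ _
      rw [LinearMap.smul_apply, hij, serreCoord_serreVec hj hj, if_pos rfl, h1]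
      simp
    · simp
    · have hle : i - Pi.single κ 1 ≤ s := fun ν => (Nat.sub_le _ _).trans (hi ν)
      rw [LinearMap.smul_apply, serreCoord_serreVec hle hj, if_neg]
      · simp
      · rintro h
        refine h1 ?_
        rw [← h]
        exact (tsub_add_cancel_of_le (single_one_le (by omega))).symm

/-- Coordinates of vectors in the image of a power of a raising operator. -/
theorem serreCoord_raising_pow (κ : k →+* F) (n : ℕ) {i : (k →+* F) → ℕ} (hi : i κ < n)
    (v : SerreSpace F k s) : serreCoord s i ((raising t s κ ^ n) v) = 0 := by
  induction n generalizing i with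
  | zero => omega
  | succ n ih =>
    obtain ⟨c, hc⟩ := serreCoord_raising p hp2 t hs κ (i := i)
    have h := LinearMap.congr_fun hc ((raising t s κ ^ n) v)
    rw [LinearMap.comp_apply] at h
    rw [pow_succ', Module.End.mul_apply, h]
    split_ifs with h0
    · rfl
    · rw [LinearMap.smul_apply, ih (by simp; omega), smul_zero]

/-- Weak regularity keeps the coefficients of the raising and lowering operators below `p`, hence
invertible in `F` when nonzero. -/
theorem natCast_ne_zero_of_le {n : ℕ} (hn : n ≠ 0) (κ : k →+* F) (hnm : n ≤ s κ) :
    (n : F) ≠ 0 := by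
  rw [Ne, CharP.cast_eq_zero_iff F p]
  intro h
  have := Nat.le_of_dvd (by omega) h
  have := hs κ
  omega

/-- The lowest weight vector spans the invariants of the lower unipotent subgroup. -/
theorem exists_eq_smul_of_lowerUnip_fixed {v : SerreSpace F k s}
    (hv : ∀ x, serreWeight t s (lowerUnip x) v = v) : ∃ c : F, v = c • serreVec s 0 := by
  refine ⟨serreCoord s 0 v, eq_of_serreCoord_eq fun i hi => ?_⟩
  have h0 : (0 : (k →+* F) → ℕ) ≤ s := fun κ => Nat.zero_le _
  rw [map_smul, serreCoord_serreVec hi h0, smul_eq_mul]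
  split_ifs with hi0
  · rw [hi0, mul_one]
  obtain ⟨κ, hκ⟩ : ∃ κ, i κ ≠ 0 := by
    by_contra! h
    exact hi0 (funext h)
  have hle : i - Pi.single κ 1 ≤ s := fun ν => (Nat.sub_le _ _).trans (hi ν)
  -- The transposed lowering operator recovers the coordinate at `i` up to an invertible factor,
  -- whereas a fixed vector is killed by lowering. So every coordinate away from `0` vanishes.
  have key : serreCoord s (i - Pi.single κ 1) ∘ₗ lowering t s κ = -(i κ : F) • serreCoord s i := by
    refine serreSpace_hom_ext fun j hj => ?_
    have hjle : j - Pi.single κ 1 ≤ s := fun ν => (Nat.sub_le _ _).trans (hj ν)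
    rw [LinearMap.comp_apply, lowering_serreVec p hp2 t hs κ hj, map_smul,
      serreCoord_serreVec hle hjle, LinearMap.smul_apply, serreCoord_serreVec hi hj]
    split_ifs with h1 h2 h2
    · rw [h2]
    -- Truncated subtraction makes `j - Pi.single κ 1 = j` when `j κ = 0`; the coefficient `j κ`
    -- vanishes in that case.
    · rcases eq_or_ne (j κ) 0 with hj0 | hj0
      · simp [hj0]
      · refine absurd (funext fun ν => ?_) h2
        have h3 := congrFun h1 ν
        rw [Pi.sub_apply, Pi.sub_apply, Pi.single_apply] at h3
        split_ifs at h3 with h4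
        · subst h4; omega
        · simpa using h3
    · exact absurd (by rw [h2]) h1
    · simp
  have h1 := LinearMap.congr_fun key v
  have h2 : lowering t s κ v = 0 := by
    simp only [lowering, LinearMap.sum_apply, LinearMap.smul_apply, hv]
    rw [← Finset.sum_smul, sum_inv_eq_zero p hp2, zero_smul]
  rw [LinearMap.comp_apply, h2, map_zero, LinearMap.smul_apply, smul_eq_mul] at h1
  have h3 := natCast_ne_zero_of_le p hp2 hs hκ κ (hi κ)
  rw [mul_zero]
  exact (mul_eq_zero.1 h1.symm).resolve_left (neg_ne_zero.2 h3)

/-- A Serre weight is generated by its lowest weight vector under the upper unipotent subgroup. -/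
theorem eq_zero_of_upperUnip_comm {M : Type*} [AddCommGroup M] [Module F M]
    (τ : Representation F (GL (Fin 2) k) M) {φ : SerreSpace F k s →ₗ[F] M}
    (hφ : ∀ x v, φ (serreWeight t s (upperUnip x) v) = τ (upperUnip x) (φ v))
    (h0 : φ (serreVec s 0) = 0) : φ = 0 := by
  refine serreSpace_hom_ext fun i hi => ?_
  rw [LinearMap.zero_apply]
  obtain ⟨n, hn⟩ : ∃ n, ∑ κ, i κ = n := ⟨_, rfl⟩
  induction n generalizing i with
  | zero =>
    obtain rfl : i = 0 := funext fun κ => Finset.sum_eq_zero_iff.1 hn κ (Finset.mem_univ _)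
    exact h0
  | succ n ih =>
    obtain ⟨κ, hκ⟩ : ∃ κ, i κ ≠ 0 := by
      by_contra! h
      simp [h] at hn
    set j := i - Pi.single κ 1 with hj
    have hij : j + Pi.single κ 1 = i := tsub_add_cancel_of_le (single_one_le hκ)
    have hjn : ∑ κ, j κ = n := by
      rw [← hij] at hn
      simpa [Finset.sum_add_distrib] using hn
    have hjs : j ≤ s := fun ν => (Nat.sub_le _ _).trans (hi ν)
    have h1 := ih j hjs hjn
    -- Commuting with upper unipotents, `φ` carries raising to the same sum of unipotents on `M`, so
    -- the vanishing passes from `j` to `j + Pi.single κ 1`.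
    have h2 : φ (raising t s κ (serreVec s j)) = 0 := by
      simp [raising, hφ, h1]
    rw [raising_serreVec p hp2 t hs, map_smul, hij] at h2
    refine (smul_eq_zero.1 h2).resolve_left (neg_ne_zero.2 ?_)
    have hik : i κ ≤ s κ := hi κ
    have hjk : j κ = i κ - 1 := by rw [hj, Pi.sub_apply, Pi.single_eq_same]
    have hne : s κ - j κ ≠ 0 := by omega
    exact natCast_ne_zero_of_le p hp2 hs hne κ (Nat.sub_le _ _)

end

/-- The torus weight at index `i` is the lowest weight times `embProd i` of `a/d`; denominators are
cleared so that only natural exponents appear. -/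
theorem serreCoord_weight {t : (k →+* F) → ℤ} {s i : (k →+* F) → ℕ} {a d : kˣ} {c : F}
    {v : SerreSpace F k s} (hv : serreWeight t s (diagGL a d) v = c • v)
    (hi : serreCoord s i v ≠ 0) :
    c * embProd i (d : k) = lowestWeight t s a d * embProd i (a : k) := by
  classical
  have his : i ≤ s := by
    by_contra h
    exact hi (by rw [serreCoord_of_not_le h, LinearMap.zero_apply])
  have key : serreCoord s i ∘ₗ serreWeight t s (diagGL a d) =
      (detChar t (a * d) * (embProd i (a : k) * embProd (s - i) (d : k))) • serreCoord s i := by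
    refine serreSpace_hom_ext fun j hj => ?_
    rw [LinearMap.comp_apply, serreWeight_diagGL, map_smul, LinearMap.smul_apply,
      serreCoord_serreVec his hj]
    split_ifs with h
    · rw [h]
    · simp
  have h := LinearMap.congr_fun key v
  rw [LinearMap.comp_apply, hv, map_smul, LinearMap.smul_apply, smul_eq_mul, smul_eq_mul] at h
  have h2 : embProd s (d : k) = embProd (s - i) (d : k) * embProd i (d : k) := by
    rw [← embProd_add, tsub_add_cancel_of_le his]
  rw [mul_right_cancel₀ hi h, lowestWeight, h2]
  ring

end SerreWeightStructure

/-! ### Congruence subgroups -/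

section Congruence

variable {O : Type u} [CommRing O] [IsLocalRing O]

theorem inv_mul_mem_congruenceSubgroup {n : ℕ} {g h : GL (Fin 2) O}
    (H : ∀ i j, g i j - h i j ∈ IsLocalRing.maximalIdeal O ^ n) :
    h⁻¹ * g ∈ congruenceSubgroup O n := by
  rw [congruenceSubgroup, MonoidHom.mem_ker, map_mul, map_inv, inv_mul_eq_one, eq_comm,
    Matrix.GeneralLinearGroup.ext_iff]
  intro i j
  rw [Matrix.GeneralLinearGroup.map_apply, Matrix.GeneralLinearGroup.map_apply, Ideal.Quotient.eq]
  exact H i j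

theorem congruenceSubgroup_anti {m n : ℕ} (h : m ≤ n) :
    congruenceSubgroup O n ≤ congruenceSubgroup O m := by
  intro g hg
  rw [mem_congruenceSubgroup_iff] at hg ⊢
  exact fun i j => Ideal.pow_le_pow_right h (hg i j)

theorem reductionHom_eq_one {g : GL (Fin 2) O} (hg : g ∈ congruenceSubgroup O 1) :
    reductionHom O g = 1 := by
  rw [mem_congruenceSubgroup_iff] at hg
  rw [Matrix.GeneralLinearGroup.ext_iff]
  intro i j
  have h := hg i j
  rw [pow_one, ← IsLocalRing.residue_eq_zero_iff, map_sub, sub_eq_zero] at h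
  rw [reductionHom, Matrix.GeneralLinearGroup.map_apply, h]
  simp [Matrix.one_apply, apply_ite]

theorem mem_congruenceSubgroup_one_of_reductionHom_eq_one {g : GL (Fin 2) O}
    (hg : reductionHom O g = 1) : g ∈ congruenceSubgroup O 1 := by
  rw [mem_congruenceSubgroup_iff]
  intro i j
  have h := congrArg (fun x : GL (Fin 2) (IsLocalRing.ResidueField O) => x i j) hg
  simp only [reductionHom, Matrix.GeneralLinearGroup.map_apply] at h
  rw [pow_one, ← IsLocalRing.residue_eq_zero_iff, map_sub, sub_eq_zero, h]
  simp [Matrix.one_apply, apply_ite]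

theorem reductionHom_surjective : Function.Surjective (reductionHom O) := by
  intro g
  choose A hA using fun i j => IsLocalRing.residue_surjective (g i j)
  have hmap : (IsLocalRing.residue O).mapMatrix (Matrix.of A) = (g : Matrix (Fin 2) (Fin 2) _) := by
    ext i j
    exact hA i j
  have hdet : IsUnit (Matrix.of A).det := by
    rw [← IsLocalRing.residue_ne_zero_iff_isUnit, RingHom.map_det, hmap]
    exact (Matrix.isUnits_det_units g).ne_zero
  refine ⟨Matrix.GeneralLinearGroup.mk'' _ hdet, ?_⟩
  rw [Matrix.GeneralLinearGroup.ext_iff]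
  exact hA

variable {p : ℕ}

theorem isUnit_det_one_add (hp : (p : O) ∈ IsLocalRing.maximalIdeal O) (A : Matrix (Fin 2) (Fin 2) O) : IsUnit (1 + (p : O) • A).det := by
  rw [← IsLocalRing.residue_ne_zero_iff_isUnit, RingHom.map_det]
  have : (IsLocalRing.residue O).mapMatrix (1 + (p : O) • A) = 1 := by
    rw [map_add, map_one]
    convert add_zero (1 : Matrix (Fin 2) (Fin 2) (IsLocalRing.ResidueField O))
    ext i j
    have : IsLocalRing.residue O (p : O) = 0 := (IsLocalRing.residue_eq_zero_iff _).2 hp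
    simp only [RingHom.mapMatrix_apply, Matrix.map_apply, Matrix.smul_apply, smul_eq_mul, map_mul,
      this, zero_mul, Matrix.zero_apply]
  rw [this, Matrix.det_one]
  exact one_ne_zero

variable (hp : (p : O) ∈ IsLocalRing.maximalIdeal O)

/-- The element `1 + pA` of `GL₂(O)`. -/
noncomputable def oneAddGL (A : Matrix (Fin 2) (Fin 2) O) : GL (Fin 2) O :=
  Matrix.GeneralLinearGroup.mk'' (1 + (p : O) • A) (isUnit_det_one_add hp A)

theorem coe_oneAddGL (A : Matrix (Fin 2) (Fin 2) O) :
    (oneAddGL hp A : Matrix (Fin 2) (Fin 2) O) = 1 + (p : O) • A := rfl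

theorem oneAddGL_apply (A : Matrix (Fin 2) (Fin 2) O) (i j : Fin 2) :
    oneAddGL hp A i j = (1 : Matrix (Fin 2) (Fin 2) O) i j + p * A i j := by
  rw [coe_oneAddGL]; rfl

theorem oneAddGL_mem {n : ℕ} {A : Matrix (Fin 2) (Fin 2) O}
    (hA : ∀ i j, A i j ∈ IsLocalRing.maximalIdeal O ^ n) :
    oneAddGL hp A ∈ congruenceSubgroup O (n + 1) := by
  rw [mem_congruenceSubgroup_iff]
  intro i j
  rw [oneAddGL_apply, add_sub_cancel_left, pow_succ']
  exact Ideal.mul_mem_mul hp (hA i j)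

theorem oneAddGL_mem_one (A : Matrix (Fin 2) (Fin 2) O) :
    oneAddGL hp A ∈ congruenceSubgroup O 1 :=
  oneAddGL_mem hp (n := 0) fun i j => by simp

theorem oneAddGL_conj (x : GL (Fin 2) O) (A : Matrix (Fin 2) (Fin 2) O) :
    oneAddGL hp ((x : Matrix (Fin 2) (Fin 2) O) * A * (x⁻¹ : GL (Fin 2) O)) = x * oneAddGL hp A * x⁻¹ := by
  refine Units.ext ?_
  rw [Units.val_mul, Units.val_mul, coe_oneAddGL, coe_oneAddGL, mul_add, add_mul, mul_one,
    Units.mul_inv, Matrix.mul_smul, Matrix.smul_mul]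

theorem oneAddGL_single (x : O) :
    oneAddGL hp !![0, x; 0, 0] = upperUnip ((p : O) * x) := by
  refine Units.ext ?_
  rw [coe_oneAddGL]
  ext i j; fin_cases i <;> fin_cases j <;> simp [upperUnip]

theorem exists_eq_oneAddGL (hm : IsLocalRing.maximalIdeal O = Ideal.span {(p : O)})
    {n : ℕ} {g : GL (Fin 2) O} (hg : g ∈ congruenceSubgroup O (n + 1)) :
    ∃ B : Matrix (Fin 2) (Fin 2) O, g = oneAddGL hp ((p : O) ^ n • B) := by
  rw [mem_congruenceSubgroup_iff] at hg
  simp only [hm, Ideal.span_singleton_pow, Ideal.mem_span_singleton] at hg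
  choose B hB using hg
  refine ⟨Matrix.of B, ?_⟩
  rw [Matrix.GeneralLinearGroup.ext_iff]
  intro i j
  rw [oneAddGL_apply, ← sub_eq_iff_eq_add', hB, pow_succ', mul_assoc]
  rfl

/-- In the binomial expansion the terms of degree `2 ≤ j < p` gain a factor `p` from the binomial
coefficient, and `n * j + 1 ≥ n + 2`. The term of degree `p` needs `n * p ≥ n + 2`, which for `n =
1` requires `p` odd. -/
theorem one_add_pow_eq [Fact p.Prime] (hp2 : 2 < p) {n : ℕ} (hn : n ≠ 0)
    (B : Matrix (Fin 2) (Fin 2) O) :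
    ∃ D : Matrix (Fin 2) (Fin 2) O,
      (1 + (p : O) ^ n • B) ^ p = 1 + (p : O) ^ (n + 1) • B + (p : O) ^ (n + 2) • D := by
  have hdvd : ∀ j, j + 2 ≤ p → p ^ (n + 2) ∣ p ^ (n * (j + 2)) * p.choose (j + 2) := by
    intro j hj
    rcases hj.eq_or_lt with h | h
    · refine Dvd.dvd.mul_right (pow_dvd_pow p ?_) _
      rw [h]
      have : 1 ≤ n := Nat.one_le_iff_ne_zero.2 hn
      nlinarith
    · have h1 : p ∣ p.choose (j + 2) := (Fact.out : p.Prime).dvd_choose_self (by omega) h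
      rw [show n + 2 = (n + 1) + 1 by ring, pow_succ p (n + 1)]
      refine mul_dvd_mul (pow_dvd_pow p ?_) h1
      have : 1 ≤ n := Nat.one_le_iff_ne_zero.2 hn
      nlinarith
  choose! c hc using hdvd
  refine ⟨∑ j ∈ Finset.range (p - 1), (c j : O) • B ^ (j + 2), ?_⟩
  rw [add_comm 1, (Commute.one_right _).add_pow, show p + 1 = p - 1 + 1 + 1 by omega,
    Finset.sum_range_succ', Finset.sum_range_succ', Finset.smul_sum]
  have hterm : ∀ j ∈ Finset.range (p - 1),
      ((p : O) ^ n • B) ^ (j + 1 + 1) * 1 ^ (p - (j + 1 + 1)) * (p.choose (j + 1 + 1)) =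
        (p : O) ^ (n + 2) • (c j : O) • B ^ (j + 2) := by
    intro j hj
    have hj' : j + 2 ≤ p := by have := Finset.mem_range.1 hj; omega
    have h := congrArg (Nat.cast : ℕ → O) (hc j hj')
    push_cast at h
    rw [one_pow, mul_one, smul_pow, ← pow_mul, smul_smul, ← h, ← nsmul_eq_mul', ← Nat.cast_smul_eq_nsmul O,
      smul_smul, mul_comm]
  rw [Finset.sum_congr rfl hterm]
  simp only [zero_add, pow_one, one_pow, mul_one, Nat.choose_one_right, pow_zero, Nat.choose_zero_right,
    Nat.cast_one]
  rw [← nsmul_eq_mul', ← Nat.cast_smul_eq_nsmul O, smul_smul, ← pow_succ']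
  abel

end Congruence

/-! ### The action of the first congruence subgroup on an extension -/

namespace RepExtension

variable {O : Type u} [CommRing O] [IsLocalRing O] {F : Type u} [Field F]
  {V W : Type u} [AddCommGroup V] [Module F V] [AddCommGroup W] [Module F W]
  {σ : Representation F (GL (Fin 2) (IsLocalRing.ResidueField O)) V}
  {τ : Representation F (GL (Fin 2) (IsLocalRing.ResidueField O)) W}
  (X : RepExtension (inflate (O := O) σ) (inflate (O := O) τ))

theorem exists_section : ∃ r : V →ₗ[F] X.E, X.proj.toLinearMap ∘ₗ r = LinearMap.id :=
  LinearMap.exists_rightInverse_of_surjective _ (LinearMap.range_eq_top.2 X.surjective)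

theorem exists_retraction : ∃ l : X.E →ₗ[F] W, l ∘ₗ X.incl.toLinearMap = LinearMap.id :=
  LinearMap.exists_leftInverse_of_injective _ (LinearMap.ker_eq_bot.2 X.injective)

/-- A linear section of the projection of an extension. -/
noncomputable def sec : V →ₗ[F] X.E := X.exists_section.choose

theorem proj_sec (v : V) : X.proj (X.sec v) = v :=
  LinearMap.congr_fun X.exists_section.choose_spec v

/-- The homomorphism `𝒦₁ → Hom(σ, τ)` describing the action of `𝒦₁` on an extension (with a
meaningless value outside `𝒦₁`). -/
noncomputable def defect (g : GL (Fin 2) O) : V →ₗ[F] W :=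
  X.exists_retraction.choose ∘ₗ (X.ρ g - 1) ∘ₗ X.sec

theorem proj_ρ (g : GL (Fin 2) O) (x : X.E) :
    X.proj (X.ρ g x) = σ (reductionHom O g) (X.proj x) :=
  X.proj.isIntertwining _ _ g x

theorem ρ_incl (g : GL (Fin 2) O) (w : W) :
    X.ρ g (X.incl w) = X.incl (τ (reductionHom O g) w) :=
  (X.incl.isIntertwining _ _ g w).symm

variable {g h : GL (Fin 2) O} (hg : g ∈ congruenceSubgroup O 1) (hh : h ∈ congruenceSubgroup O 1)

include hg

/-- Since `𝒦₁` acts trivially on both ends, `ρ g - 1` kills `τ` and takes values in `τ`. It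
therefore factors through a map `σ → τ`, whatever section and retraction were chosen. -/
theorem ρ_apply_eq (x : X.E) : X.ρ g x = x + X.incl (X.defect g (X.proj x)) := by
  have hr := reductionHom_eq_one hg
  obtain ⟨w, hw⟩ := (X.exact (x - X.sec (X.proj x))).1 (by
    rw [map_sub, X.proj_sec, sub_self])
  obtain ⟨w', hw'⟩ := (X.exact (X.ρ g (X.sec (X.proj x)) - X.sec (X.proj x))).1 (by
    rw [map_sub, X.proj_ρ, hr, map_one, Module.End.one_apply, sub_self])
  have hd : X.defect g (X.proj x) = w' := by
    rw [defect, LinearMap.comp_apply, LinearMap.comp_apply, LinearMap.sub_apply,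
      Module.End.one_apply, ← hw']
    exact LinearMap.congr_fun X.exists_retraction.choose_spec w'
  have hx : x = X.incl w + X.sec (X.proj x) := by rw [hw]; abel
  rw [hd, hw']
  have h1 : X.ρ g x = X.incl w + X.ρ g (X.sec (X.proj x)) := by
    conv_lhs => rw [hx]
    rw [map_add, X.ρ_incl, hr, map_one, Module.End.one_apply]
  rw [h1, hw]
  abel

theorem defect_eq_zero_of_fixed {x : X.E} (hx : X.ρ g x = x) : X.defect g (X.proj x) = 0 := by
  rw [X.ρ_apply_eq hg, add_eq_left] at hx
  exact X.injective (by rw [hx, map_zero])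

/-- Compare the two sides of `ρ(x g x⁻¹) ρ(x) = ρ(x) ρ(g)`. Composing with `σ(x)` on the right
avoids an inverse. -/
theorem defect_conj (x : GL (Fin 2) O) :
    X.defect (x * g * x⁻¹) ∘ₗ σ (reductionHom O x) = τ (reductionHom O x) ∘ₗ X.defect g := by
  have hc : x * g * x⁻¹ ∈ congruenceSubgroup O 1 :=
    (inferInstance : (congruenceSubgroup O 1).Normal).conj_mem _ hg x
  ext v
  apply X.injective
  obtain ⟨y, rfl⟩ := X.surjective v
  rw [LinearMap.comp_apply, LinearMap.comp_apply, ← X.ρ_incl, ← X.proj_ρ]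
  have h1 := X.ρ_apply_eq hc (X.ρ x y)
  have h2 := congrArg (X.ρ x) (X.ρ_apply_eq hg y)
  rw [map_add] at h2
  rw [← Module.End.mul_apply, ← map_mul, inv_mul_cancel_right, map_mul, Module.End.mul_apply, h2]
    at h1
  exact (add_left_cancel h1).symm

include hh

/-- In `(1 + N_g)(1 + N_h)` the product `N_g N_h` vanishes, because the image of `N_h` lies in `τ`.
-/
theorem defect_mul : X.defect (g * h) = X.defect g + X.defect h := by
  ext v
  apply X.injective
  obtain ⟨x, rfl⟩ := X.surjective v
  have h1 := X.ρ_apply_eq (mul_mem hg hh) x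
  rw [map_mul, Module.End.mul_apply, X.ρ_apply_eq hh, map_add, X.ρ_apply_eq hg, X.ρ_incl,
    reductionHom_eq_one hg, map_one, Module.End.one_apply, add_assoc] at h1
  rw [LinearMap.add_apply, map_add, add_left_cancel h1.symm]

omit hh

theorem defect_pow (n : ℕ) : X.defect (g ^ (n + 1)) = (n + 1 : ℕ) • X.defect g := by
  induction n with
  | zero => simp
  | succ n ih =>
    rw [pow_succ, X.defect_mul (pow_mem hg _) hg, ih]
    exact (succ_nsmul _ _).symm

variable {p : ℕ} [Fact p.Prime] [CharP F p]

theorem defect_pow_char : X.defect (g ^ p) = 0 := by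
  obtain ⟨n, rfl⟩ : ∃ n, p = n + 1 := ⟨p - 1, by have := (Fact.out : p.Prime).pos; omega⟩
  rw [X.defect_pow hg, ← Nat.cast_smul_eq_nsmul F, CharP.cast_eq_zero, zero_smul]

end RepExtension

/-! ### Smooth extensions: triviality on `𝒦₂` and the induced additive map on matrices -/

section Smooth

namespace RepExtension

variable {O : Type u} [CommRing O] [IsLocalRing O] {F : Type u} [Field F]
  {V W : Type u} [AddCommGroup V] [Module F V] [AddCommGroup W] [Module F W]
  {σ : Representation F (GL (Fin 2) (IsLocalRing.ResidueField O)) V}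
  {τ : Representation F (GL (Fin 2) (IsLocalRing.ResidueField O)) W}
  (X : RepExtension (inflate (O := O) σ) (inflate (O := O) τ))
  {p : ℕ} [Fact p.Prime] [CharP F p]
  (hm : IsLocalRing.maximalIdeal O = Ideal.span {(p : O)})

theorem natCast_mem (hm : IsLocalRing.maximalIdeal O = Ideal.span {(p : O)}) :
    (p : O) ∈ IsLocalRing.maximalIdeal O := by
  rw [hm]; exact Ideal.mem_span_singleton_self _

include hm

/-- On a smooth extension with `p` odd, the second congruence subgroup acts trivially. -/
theorem defect_eq_zero_of_mem_two (hp2 : 2 < p) (hX : IsSmoothRep X.ρ) {g : GL (Fin 2) O}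
    (hg : g ∈ congruenceSubgroup O 2) : X.defect g = 0 := by
  have hp := natCast_mem hm
  ext v
  -- Smoothness gives a level depending on the vector, so `v` is fixed throughout the descent.
  obtain ⟨n, hn⟩ := hX (X.sec v)
  have hbig : ∀ g ∈ congruenceSubgroup O (n + 2), X.defect g v = 0 := fun g hg => by
    have := X.defect_eq_zero_of_fixed (congruenceSubgroup_anti (by omega) hg)
      (hn g (congruenceSubgroup_anti (by omega) hg))
    rwa [X.proj_sec] at this
  -- An element `1 + p^(m+2) B` of `𝒦_(m+2)` is, modulo `𝒦_(m+3)`, the `p`-th power of `1 + p^(m+1)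
  -- B`, and `defect` kills `p`-th powers.
  have hstep : ∀ m, (∀ g ∈ congruenceSubgroup O (m + 3), X.defect g v = 0) →
      ∀ g ∈ congruenceSubgroup O (m + 2), X.defect g v = 0 := by
    intro m ih g hg
    obtain ⟨B, hB⟩ := exists_eq_oneAddGL hp hm (n := m + 1) hg
    obtain ⟨D, hD⟩ := one_add_pow_eq hp2 (Nat.succ_ne_zero m) B
    set h := oneAddGL hp ((p : O) ^ m • B) with hh
    have hh1 : h ∈ congruenceSubgroup O 1 := oneAddGL_mem_one hp _
    have hg1 : g ∈ congruenceSubgroup O 1 := congruenceSubgroup_anti (by omega) hg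
    have hval : ((h ^ p : GL (Fin 2) O) : Matrix (Fin 2) (Fin 2) O) =
        g + (p : O) ^ (m + 3) • D := by
      rw [Units.val_pow_eq_pow_val, hh, coe_oneAddGL, smul_smul, ← pow_succ', hD, hB, coe_oneAddGL,
        smul_smul, ← pow_succ']
    have hmem : g⁻¹ * h ^ p ∈ congruenceSubgroup O (m + 3) := by
      refine inv_mul_mem_congruenceSubgroup fun i j => ?_
      rw [hval, Matrix.add_apply, add_sub_cancel_left, Matrix.smul_apply, smul_eq_mul]
      exact Ideal.mul_mem_right _ _ (Ideal.pow_mem_pow hp _)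
    have h1 := X.defect_pow_char (p := p) hh1
    rw [← mul_inv_cancel_left g (h ^ p), X.defect_mul hg1
      (congruenceSubgroup_anti (by omega) hmem)] at h1
    have h2 := LinearMap.congr_fun h1 v
    rwa [LinearMap.add_apply, ih _ hmem, add_zero] at h2
  have hall : ∀ m, ∀ g ∈ congruenceSubgroup O (n - m + 2), X.defect g v = 0 := by
    intro m
    induction m with
    | zero => exact hbig
    | succ m ih =>
      rcases Nat.lt_or_ge m n with h | h
      · refine hstep _ ?_
        rw [show n - (m + 1) + 3 = n - m + 2 by omega]
        exact ih
      · rw [show n - (m + 1) = n - m by omega]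
        exact ih
  exact hall n g (by rwa [Nat.sub_self])

/-- The additive map `M₂(O) → Hom(σ, τ)`, `A ↦ (1 + pA) - 1`. -/
noncomputable def matDefect (hp2 : 2 < p) (hX : IsSmoothRep X.ρ) :
    Matrix (Fin 2) (Fin 2) O →+ (V →ₗ[F] W) :=
  AddMonoidHom.mk' (fun A => X.defect (oneAddGL (natCast_mem hm) A)) fun A B => by
    have hp := natCast_mem hm
    rw [← X.defect_mul (oneAddGL_mem_one hp A) (oneAddGL_mem_one hp B)]
    -- `(1 + pA)(1 + pB)` and `1 + p(A + B)` differ by `p²AB`, which is invisible modulo `𝒦₂`.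
    have hmem : (oneAddGL hp (A + B))⁻¹ * (oneAddGL hp A * oneAddGL hp B) ∈
        congruenceSubgroup O 2 := by
      refine inv_mul_mem_congruenceSubgroup fun i j => ?_
      have : ((oneAddGL hp A * oneAddGL hp B : GL (Fin 2) O) : Matrix (Fin 2) (Fin 2) O) -
          oneAddGL hp (A + B) = ((p : O) ^ 2) • (A * B) := by
        rw [Units.val_mul, coe_oneAddGL, coe_oneAddGL, coe_oneAddGL, add_mul, mul_add, mul_add,
          one_mul, mul_one, one_mul, Matrix.smul_mul, Matrix.mul_smul, smul_smul, smul_add, sq]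
        abel
      have h1 := congrFun (congrFun this i) j
      rw [Matrix.sub_apply] at h1
      rw [h1, Matrix.smul_apply, smul_eq_mul]
      exact Ideal.mul_mem_right _ _ (Ideal.pow_mem_pow hp _)
    rw [← mul_inv_cancel_left (oneAddGL hp (A + B)) (oneAddGL hp A * oneAddGL hp B),
      X.defect_mul (oneAddGL_mem_one hp _) (congruenceSubgroup_anti one_le_two hmem),
      X.defect_eq_zero_of_mem_two hm hp2 hX hmem, add_zero]

variable (hp2 : 2 < p) (hX : IsSmoothRep X.ρ)

theorem matDefect_apply (A : Matrix (Fin 2) (Fin 2) O) :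
    X.matDefect hm hp2 hX A = X.defect (oneAddGL (natCast_mem hm) A) := rfl

theorem matDefect_eq_zero {A : Matrix (Fin 2) (Fin 2) O}
    (hA : ∀ i j, A i j ∈ IsLocalRing.maximalIdeal O) : X.matDefect hm hp2 hX A = 0 :=
  X.defect_eq_zero_of_mem_two hm hp2 hX
    (oneAddGL_mem (n := 1) (natCast_mem hm) (by simpa using hA))

theorem matDefect_conj (x : GL (Fin 2) O) (A : Matrix (Fin 2) (Fin 2) O) :
    X.matDefect hm hp2 hX ((x : Matrix (Fin 2) (Fin 2) O) * A * (x⁻¹ : GL (Fin 2) O)) ∘ₗ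
      σ (reductionHom O x) = τ (reductionHom O x) ∘ₗ X.matDefect hm hp2 hX A := by
  rw [matDefect_apply, matDefect_apply, oneAddGL_conj]
  exact X.defect_conj (oneAddGL_mem_one _ _) x

theorem matDefect_smul_congr {a b : O} (h : IsLocalRing.residue O a = IsLocalRing.residue O b)
    (A : Matrix (Fin 2) (Fin 2) O) :
    X.matDefect hm hp2 hX (a • A) = X.matDefect hm hp2 hX (b • A) := by
  rw [← sub_eq_zero, ← map_sub, ← sub_smul]
  refine X.matDefect_eq_zero hm hp2 hX fun i j => ?_
  rw [Matrix.smul_apply, smul_eq_mul]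
  refine Ideal.mul_mem_right _ _ ?_
  rw [← IsLocalRing.residue_eq_zero_iff, map_sub, h, sub_self]

end RepExtension

end Smooth

/-- Additivity of Frobenius on pairwise commuting elements; the ring is not assumed commutative
because it will be an endomorphism algebra. -/
theorem sum_pow_char_of_commute (p : ℕ) [Fact p.Prime] {ι R : Type*} [Ring R] [CharP R p]
    (s : Finset ι) (a : ι → R) (h : ∀ i j, Commute (a i) (a j)) :
    (∑ i ∈ s, a i) ^ p = ∑ i ∈ s, a i ^ p := by
  classical
  have : ExpChar R p := ExpChar.prime Fact.out
  induction s using Finset.induction_on with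
  | empty => simp [(Fact.out : p.Prime).ne_zero]
  | insert i s hi ih =>
    rw [Finset.sum_insert hi, Finset.sum_insert hi,
      add_pow_expChar_of_commute p (Commute.sum_right _ _ _ fun j _ => h i j), ih]

namespace RepExtension

/-! ### Decomposition into semilinear components -/

section Components

variable {O : Type u} [CommRing O] [IsLocalRing O] [Fintype (IsLocalRing.ResidueField O)]
  {F : Type u} [Field F]
  {V W : Type u} [AddCommGroup V] [Module F V] [AddCommGroup W] [Module F W]
  {σ : Representation F (GL (Fin 2) (IsLocalRing.ResidueField O)) V}
  {τ : Representation F (GL (Fin 2) (IsLocalRing.ResidueField O)) W}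
  (X : RepExtension (inflate (O := O) σ) (inflate (O := O) τ))
  {p : ℕ} [Fact p.Prime] [CharP F p]
  (hm : IsLocalRing.maximalIdeal O = Ideal.span {(p : O)})
  (hp2 : 2 < p) (hX : IsSmoothRep X.ρ)

/-- A set-theoretic section of the reduction map. -/
noncomputable def residueLift (x : IsLocalRing.ResidueField O) : O :=
  Function.surjInv IsLocalRing.residue_surjective x

theorem residue_residueLift (x : IsLocalRing.ResidueField O) :
    IsLocalRing.residue O (residueLift x) = x :=
  Function.surjInv_eq IsLocalRing.residue_surjective x

/-- The `κ`-semilinear component of `matDefect` (up to sign). -/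
noncomputable def component (κ : IsLocalRing.ResidueField O →+* F) :
    Matrix (Fin 2) (Fin 2) O →+ (V →ₗ[F] W) :=
  AddMonoidHom.mk' (fun A => ∑ x : IsLocalRing.ResidueField O,
    (κ x)⁻¹ • X.matDefect hm hp2 hX (residueLift x • A)) fun A B => by
      simp only [smul_add, map_add, Finset.sum_add_distrib]

theorem component_apply (κ : IsLocalRing.ResidueField O →+* F) (A : Matrix (Fin 2) (Fin 2) O) :
    X.component hm hp2 hX κ A = ∑ x : IsLocalRing.ResidueField O,
      (κ x)⁻¹ • X.matDefect hm hp2 hX (residueLift x • A) := rfl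

/-- Reindexing the sum by multiplication by the residue of `c` moves that residue into the weight
`κ(x)⁻¹`. Lifts are interchangeable because `matDefect` only sees residues. -/
theorem component_smul (κ : IsLocalRing.ResidueField O →+* F) (c : O)
    (A : Matrix (Fin 2) (Fin 2) O) :
    X.component hm hp2 hX κ (c • A) =
      κ (IsLocalRing.residue O c) • X.component hm hp2 hX κ A := by
  have h1 : ∀ x : IsLocalRing.ResidueField O, X.matDefect hm hp2 hX (residueLift x • c • A) =
      X.matDefect hm hp2 hX (residueLift (x * IsLocalRing.residue O c) • A) := fun x => by
    rw [smul_smul]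
    exact X.matDefect_smul_congr hm hp2 hX
      (by rw [map_mul, residue_residueLift, residue_residueLift]) A
  rw [component_apply, component_apply]
  simp only [h1]
  by_cases hc : IsLocalRing.residue O c = 0
  · have h2 : X.matDefect hm hp2 hX (residueLift (0 : IsLocalRing.ResidueField O) • A) = 0 := by
      rw [X.matDefect_smul_congr hm hp2 hX (b := 0) (by rw [residue_residueLift, map_zero]),
        zero_smul, map_zero]
    simp [hc, h2]
  · rw [Finset.smul_sum, ← Equiv.sum_comp (Equiv.mulRight₀ _ hc) fun x =>
      κ (IsLocalRing.residue O c) • (κ x)⁻¹ • X.matDefect hm hp2 hX (residueLift x • A)]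
    refine Finset.sum_congr rfl fun x _ => ?_
    rw [show Equiv.mulRight₀ _ hc x = x * IsLocalRing.residue O c from rfl, smul_smul, map_mul, mul_inv, mul_comm (κ x)⁻¹,
      mul_inv_cancel_left₀ ((map_ne_zero κ).2 hc)]

theorem component_conj (κ : IsLocalRing.ResidueField O →+* F) (x : GL (Fin 2) O)
    (A : Matrix (Fin 2) (Fin 2) O) :
    X.component hm hp2 hX κ ((x : Matrix (Fin 2) (Fin 2) O) * A * (x⁻¹ : GL (Fin 2) O)) ∘ₗ
      σ (reductionHom O x) = τ (reductionHom O x) ∘ₗ X.component hm hp2 hX κ A := by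
  ext v
  simp only [component_apply, LinearMap.comp_apply, LinearMap.sum_apply, map_sum,
    LinearMap.smul_apply, map_smul]
  refine Finset.sum_congr rfl fun y _ => ?_
  rw [← LinearMap.comp_apply (τ (reductionHom O x)), ← X.matDefect_conj, Matrix.mul_smul,
    Matrix.smul_mul]
  rfl

theorem component_conj_apply (κ : IsLocalRing.ResidueField O →+* F) (x : GL (Fin 2) O)
    (A : Matrix (Fin 2) (Fin 2) O) (v : V) :
    τ (reductionHom O x) (X.component hm hp2 hX κ A v) = X.component hm hp2 hX κ
      ((x : Matrix (Fin 2) (Fin 2) O) * A * (x⁻¹ : GL (Fin 2) O)) (σ (reductionHom O x) v) :=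
  (LinearMap.congr_fun (X.component_conj hm hp2 hX κ x A) v).symm

/-- The map `c ↦ matDefect (c • A)` factors through an additive map on the residue field, which is
determined by its semilinear components. -/
theorem matDefect_smul_eq_zero [CharP (IsLocalRing.ResidueField O) p] [IsAlgClosed F]
    [Fintype (IsLocalRing.ResidueField O →+* F)] {A : Matrix (Fin 2) (Fin 2) O}
    (hA : ∀ κ, X.component hm hp2 hX κ A = 0) (c : O) : X.matDefect hm hp2 hX (c • A) = 0 := by
  let φ : IsLocalRing.ResidueField O →+ (V →ₗ[F] W) :=
    AddMonoidHom.mk' (fun x => X.matDefect hm hp2 hX (residueLift x • A)) fun x y => by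
      rw [← map_add, ← add_smul]
      exact X.matDefect_smul_congr hm hp2 hX (by simp only [map_add, residue_residueLift]) A
  have h := DFunLike.congr_fun (eq_zero_of_forall_sum_inv_smul_eq_zero p hp2 φ hA)
    (IsLocalRing.residue O c)
  rw [← X.matDefect_smul_congr hm hp2 hX (residue_residueLift (IsLocalRing.residue O c)) A]
  exact h

end Components

/-! ### The raising operator lifted to an extension -/

section SerreWeights

variable {O : Type u} [CommRing O] [IsLocalRing O] [Fintype (IsLocalRing.ResidueField O)]
  {p : ℕ} [Fact p.Prime] [CharP (IsLocalRing.ResidueField O) p]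
  {F : Type u} [Field F] [CharP F p] [IsAlgClosed F]
  [Fintype (IsLocalRing.ResidueField O →+* F)] [DecidableEq (IsLocalRing.ResidueField O →+* F)]
  {t t' : (IsLocalRing.ResidueField O →+* F) → ℤ} {s s' : (IsLocalRing.ResidueField O →+* F) → ℕ}
  (X : RepExtension (inflate (O := O) (serreWeight t s)) (inflate (O := O) (serreWeight t' s')))
  (hm : IsLocalRing.maximalIdeal O = Ideal.span {(p : O)})
  (hp2 : 2 < p) (hX : IsSmoothRep X.ρ)

/-- A lift to an extension of the raising operator; its `p`-th power recovers a component of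
`matDefect`. -/
noncomputable def liftedRaising (μ : IsLocalRing.ResidueField O →+* F) : Module.End F X.E :=
  ∑ x : IsLocalRing.ResidueField O, (μ x)⁻¹ • X.ρ (upperUnip (residueLift x))

theorem reductionHom_upperUnip (x : O) :
    reductionHom O (upperUnip x) = upperUnip (IsLocalRing.residue O x) :=
  map_upperUnip _ _

theorem reductionHom_lowerUnip (x : O) :
    reductionHom O (lowerUnip x) = lowerUnip (IsLocalRing.residue O x) :=
  map_lowerUnip _ _

theorem proj_liftedRaising_pow (μ : IsLocalRing.ResidueField O →+* F) (n : ℕ) (x : X.E) :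
    X.proj ((X.liftedRaising μ ^ n) x) = (raising t s μ ^ n) (X.proj x) := by
  induction n with
  | zero => rfl
  | succ n ih =>
    rw [pow_succ', Module.End.mul_apply, pow_succ', Module.End.mul_apply, ← ih]
    simp [liftedRaising, raising, X.proj_ρ, reductionHom_upperUnip, residue_residueLift]

theorem liftedRaising_pow_incl (μ : IsLocalRing.ResidueField O →+* F) (n : ℕ)
    (w : SerreSpace F (IsLocalRing.ResidueField O) s') :
    (X.liftedRaising μ ^ n) (X.incl w) = X.incl ((raising t' s' μ ^ n) w) := by
  induction n with
  | zero => rfl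
  | succ n ih =>
    rw [pow_succ', Module.End.mul_apply, pow_succ', Module.End.mul_apply, ih]
    simp [liftedRaising, raising, X.ρ_incl, reductionHom_upperUnip, residue_residueLift]

/-- The lifted unipotents commute, so the `p`-th power can be taken term by term, giving `∑
μ(x)^(-p) ρ(u(p x̃))`. Here `μ^p = κ` and `u(p x̃) ∈ 𝒦₁` acts as `1 + N`. The contributions of `1`
cancel since `∑ κ(x)⁻¹ = 0`. Nontriviality of `E` ensures that its endomorphism ring has
characteristic `p`. -/
theorem liftedRaising_pow_char [Nontrivial X.E] {κ μ : IsLocalRing.ResidueField O →+* F}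
    (hκ : ∀ x, κ x = μ x ^ p) (x : X.E) :
    (X.liftedRaising μ ^ p) x = X.incl (X.component hm hp2 hX κ !![0, 1; 0, 0] (X.proj x)) := by
  have : CharP (Module.End F X.E) p :=
    charP_of_injective_algebraMap (FaithfulSMul.algebraMap_injective F _) p
  have hcomm : ∀ x y : IsLocalRing.ResidueField O,
      Commute ((μ x)⁻¹ • X.ρ (upperUnip (residueLift x)))
        ((μ y)⁻¹ • X.ρ (upperUnip (residueLift y))) := by
    intro x y
    refine Commute.smul_left (Commute.smul_right ?_ _) _
    rw [commute_iff_eq, ← map_mul, ← map_mul, upperUnip_mul, upperUnip_mul, add_comm]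
  rw [liftedRaising, sum_pow_char_of_commute p _ _ hcomm, LinearMap.sum_apply, component_apply,
    LinearMap.sum_apply]
  have hterm : ∀ y : IsLocalRing.ResidueField O,
      (((μ y)⁻¹ • X.ρ (upperUnip (residueLift y))) ^ p) x = (κ y)⁻¹ • x + (κ y)⁻¹ • X.incl
        (X.matDefect hm hp2 hX (residueLift y • !![0, 1; 0, 0]) (X.proj x)) := by
    intro y
    have hmat : residueLift y • !![0, 1; 0, 0] = !![0, residueLift y; 0, 0] := by
      ext i j; fin_cases i <;> fin_cases j <;> simp
    rw [smul_pow, ← map_pow, upperUnip_pow, ← oneAddGL_single (natCast_mem hm), inv_pow, ← hκ,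
      LinearMap.smul_apply, X.ρ_apply_eq (oneAddGL_mem_one _ _), smul_add, hmat]
    rfl
  rw [Finset.sum_congr rfl fun y _ => hterm y, Finset.sum_add_distrib, ← Finset.sum_smul,
    sum_inv_eq_zero p hp2, zero_smul, zero_add, map_sum]
  simp

end SerreWeights

end RepExtension

/-! ### Lowest weight vectors and Frobenius on embeddings -/

section LowestWeightVectors

variable {p : ℕ} [Fact p.Prime] {k F : Type u} [Field k] [Fintype k] [CharP k p] [Field F]
  [CharP F p] [IsAlgClosed F] [Fintype (k →+* F)] [DecidableEq (k →+* F)]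

theorem serreVec_zero_ne_zero (s : (k →+* F) → ℕ) : serreVec s 0 ≠ 0 := by
  intro h
  have h0 : (0 : (k →+* F) → ℕ) ≤ s := fun κ => Nat.zero_le _
  have := serreCoord_serreVec h0 h0
  rw [h, map_zero, if_pos rfl] at this
  exact zero_ne_one this

/-- A nonzero such `v` would span the lowest weight line of the second weight, so the lowest weights
would agree, and these determine a weakly regular weight. -/
theorem eq_zero_of_lowest_weight (hp2 : 2 < p) {t t' : (k →+* F) → ℤ} {s s' : (k →+* F) → ℕ}
    (hs : ∀ κ, s κ ≤ p - 2) (hs' : ∀ κ, s' κ ≤ p - 2)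
    (hne : IsEmpty ((serreWeight t s).Equiv (serreWeight t' s'))) {v : SerreSpace F k s'}
    (hv : ∀ x, serreWeight t' s' (lowerUnip x) v = v)
    (hw : ∀ a d, serreWeight t' s' (diagGL a d) v = lowestWeight t s a d • v) : v = 0 := by
  obtain ⟨c, rfl⟩ := exists_eq_smul_of_lowerUnip_fixed p hp2 t' hs' hv
  by_contra h
  obtain ⟨e⟩ := nonempty_equiv_of_lowestWeight_eq p hp2 (t := t) (t' := t') hs hs' fun a d => by
    have h1 := hw a d
    rw [map_smul, serreWeight_diagGL_zero, smul_comm] at h1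
    exact (smul_left_injective F h h1).symm
  exact hne.false e

/-- The hypothesis gives `x^p = x` on `k`, so Frobenius is trivial and all twists of an embedding
coincide. -/
theorem subsingleton_of_pow_char_eq {κ : k →+* F} (h : ∀ x, κ x = κ x ^ p) :
    ∀ ν : k →+* F, ν = κ := by
  obtain ⟨f, κ₀, e, -, -, he⟩ := exists_equiv_embeddings p (k := k) (F := F)
  have hx : ∀ x : k, x ^ p = x := fun x => κ.injective (by rw [map_pow, ← h])
  have hx' : ∀ (n : ℕ) (x : k), x ^ p ^ n = x := fun n => by
    induction n with
    | zero => simp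
    | succ n ih => intro x; rw [pow_succ, pow_mul, ih, hx]
  have h0 : ∀ ν, ν = κ₀ := fun ν => by
    ext x
    rw [← e.apply_symm_apply ν, he, ← map_pow, hx']
  exact fun ν => (h0 ν).trans (h0 κ).symm

theorem exists_frobenius_preimage (p : ℕ) [Fact p.Prime] [CharP k p] (κ : k →+* F) :
    ∃ μ : k →+* F, ∀ x, κ x = μ x ^ p := by
  refine ⟨κ.comp ((frobeniusEquiv k p).symm : k →+* k), fun x => ?_⟩
  rw [RingHom.comp_apply, ← map_pow]
  congr 1
  exact (frobeniusEquiv_symm_pow_p k p x).symm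

end LowestWeightVectors

/-! ### Vanishing of the components for odd `p` -/

namespace RepExtension

variable {O : Type u} [CommRing O] [IsLocalRing O] [Fintype (IsLocalRing.ResidueField O)]
  {p : ℕ} [Fact p.Prime] [CharP (IsLocalRing.ResidueField O) p]
  {F : Type u} [Field F] [CharP F p] [IsAlgClosed F]
  [Fintype (IsLocalRing.ResidueField O →+* F)] [DecidableEq (IsLocalRing.ResidueField O →+* F)]
  {t t' : (IsLocalRing.ResidueField O →+* F) → ℤ} {s s' : (IsLocalRing.ResidueField O →+* F) → ℕ}
  (X : RepExtension (inflate (O := O) (serreWeight t s)) (inflate (O := O) (serreWeight t' s')))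
  (hm : IsLocalRing.maximalIdeal O = Ideal.span {(p : O)})
  (hp2 : 2 < p) (hX : IsSmoothRep X.ρ)

/-- Split the `p`-th power of the lifted raising operator as `p = (p - 1 - s_μ) + (s_μ + 1)`. The
last `s_μ + 1` factors to be written act first and already kill the lowest weight vector in the
quotient, hence land in `τ`. -/
theorem exists_component_eq_raising_pow (hs : ∀ κ, s κ ≤ p - 2)
    {κ μ : IsLocalRing.ResidueField O →+* F} (hκ : ∀ x, κ x = μ x ^ p) :
    ∃ z, X.component hm hp2 hX κ !![0, 1; 0, 0] (serreVec s 0) =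
      (raising t' s' μ ^ (p - 1 - s μ)) z := by
  have hne : Nontrivial X.E := by
    refine ⟨X.sec (serreVec s 0), 0, fun h => serreVec_zero_ne_zero s ?_⟩
    rw [← X.proj_sec (serreVec s 0), h, map_zero]
  obtain ⟨z, hz⟩ := (X.exact ((X.liftedRaising μ ^ (s μ + 1)) (X.sec (serreVec s 0)))).1 (by
    rw [X.proj_liftedRaising_pow, X.proj_sec, raising_pow_serreVec_zero p hp2 t hs])
  refine ⟨z, X.injective ?_⟩
  have h1 := X.liftedRaising_pow_char hm hp2 hX hκ (X.sec (serreVec s 0))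
  have h2 := hs μ
  have h3 : X.liftedRaising μ ^ p =
      X.liftedRaising μ ^ (p - 1 - s μ) * X.liftedRaising μ ^ (s μ + 1) := by
    rw [← pow_add]
    congr 1
    omega
  rw [h3, Module.End.mul_apply, ← hz, X.liftedRaising_pow_incl, X.proj_sec] at h1
  exact h1.symm

theorem component_lowerUnip (κ : IsLocalRing.ResidueField O →+* F)
    (A : Matrix (Fin 2) (Fin 2) O) (x : IsLocalRing.ResidueField O) :
    serreWeight t' s' (lowerUnip x) (X.component hm hp2 hX κ A (serreVec s 0)) =
      X.component hm hp2 hX κ (!![1, 0; residueLift x, 1] * A * !![1, 0; -residueLift x, 1])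
        (serreVec s 0) := by
  have h := X.component_conj_apply hm hp2 hX κ (lowerUnip (residueLift x)) A (serreVec s 0)
  rw [reductionHom_lowerUnip, residue_residueLift, serreWeight_lowerUnip_zero] at h
  exact h

theorem exists_units_residue (a : (IsLocalRing.ResidueField O)ˣ) :
    ∃ b : Oˣ, Units.map (IsLocalRing.residue O : O →* _) b = a := by
  obtain ⟨b, hb⟩ := IsLocalRing.residue_surjective (a : IsLocalRing.ResidueField O)
  have hu : IsUnit b := by
    rw [← IsLocalRing.residue_ne_zero_iff_isUnit, hb]
    exact a.ne_zero
  exact ⟨hu.unit, Units.ext hb⟩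

theorem reductionHom_diagGL (a d : Oˣ) :
    reductionHom O (diagGL a d) = diagGL (Units.map (IsLocalRing.residue O : O →* _) a)
      (Units.map (IsLocalRing.residue O : O →* _) d) :=
  map_diagGL _ _ _

/-- The torus weight is that of the lowest weight vector times that of `A`. The latter is supplied
through lifts, since `component` takes matrices over `O`. -/
theorem component_diagGL (κ : IsLocalRing.ResidueField O →+* F)
    (A : Matrix (Fin 2) (Fin 2) O) (a d u : (IsLocalRing.ResidueField O)ˣ)
    (hA : ∀ a' d' : Oˣ, Units.map (IsLocalRing.residue O : O →* _) a' = a →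
      Units.map (IsLocalRing.residue O : O →* _) d' = d → ∃ u' : Oˣ,
      Units.map (IsLocalRing.residue O : O →* _) u' = u ∧
      !![(a' : O), 0; 0, d'] * A * !![((a'⁻¹ : Oˣ) : O), 0; 0, ((d'⁻¹ : Oˣ) : O)] =
        (u' : O) • A) :
    serreWeight t' s' (diagGL a d) (X.component hm hp2 hX κ A (serreVec s 0)) =
      (κ u * lowestWeight t s a d) • X.component hm hp2 hX κ A (serreVec s 0) := by
  obtain ⟨a', rfl⟩ := exists_units_residue a
  obtain ⟨d', rfl⟩ := exists_units_residue d
  obtain ⟨u', rfl, hu⟩ := hA a' d' rfl rfl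
  have h := X.component_conj_apply hm hp2 hX κ (diagGL a' d') A (serreVec s 0)
  rw [reductionHom_diagGL, serreWeight_diagGL_zero, map_smul] at h
  rw [h]
  have h2 : ((diagGL a' d' : GL (Fin 2) O) : Matrix (Fin 2) (Fin 2) O) * A *
      ((diagGL a' d')⁻¹ : GL (Fin 2) O) = (u' : O) • A := hu
  rw [h2, component_smul, LinearMap.smul_apply, smul_smul, mul_comm]
  rfl

theorem component_single_eq_zero (hs : ∀ κ, s κ ≤ p - 2) (hs' : ∀ κ, s' κ ≤ p - 2)
    (hne : IsEmpty ((serreWeight t s).Equiv (serreWeight t' s')))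
    (κ : IsLocalRing.ResidueField O →+* F) :
    X.component hm hp2 hX κ !![0, 1; 0, 0] (serreVec s 0) = 0 := by
  obtain ⟨μ, hκ⟩ := exists_frobenius_preimage p κ
  set y := X.component hm hp2 hX κ !![0, 1; 0, 0] (serreVec s 0) with hy
  set yh := X.component hm hp2 hX κ !![1, 0; 0, -1] (serreVec s 0) with hyh
  set yf := X.component hm hp2 hX κ !![0, 0; 1, 0] (serreVec s 0) with hyf
  have hlow_f : ∀ x, serreWeight t' s' (lowerUnip x) yf = yf := fun x => by
    rw [hyf, component_lowerUnip]
    congr 2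
    ext i j; fin_cases i <;> fin_cases j <;> simp [Matrix.mul_apply]
  have hlow_h : ∀ x, serreWeight t' s' (lowerUnip x) yh = yh + (2 * κ x) • yf := fun x => by
    rw [hyh, component_lowerUnip]
    have : (!![1, 0; residueLift x, 1] * !![1, 0; 0, -1] * !![1, 0; -residueLift x, 1] :
        Matrix (Fin 2) (Fin 2) O) = !![1, 0; 0, -1] + (2 * residueLift x) • !![0, 0; 1, 0] := by
      ext i j; fin_cases i <;> fin_cases j <;> simp [Matrix.mul_apply]; ring
    rw [this, map_add, component_smul, map_mul, residue_residueLift, map_ofNat, map_mul, map_ofNat]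
    rfl
  have hlow_e : ∀ x, serreWeight t' s' (lowerUnip x) y = y - κ x • yh - (κ x ^ 2) • yf := fun x => by
    rw [hy, component_lowerUnip]
    have : (!![1, 0; residueLift x, 1] * !![0, 1; 0, 0] * !![1, 0; -residueLift x, 1] :
        Matrix (Fin 2) (Fin 2) O) = !![0, 1; 0, 0] - residueLift x • !![1, 0; 0, -1] -
          residueLift x ^ 2 • !![0, 0; 1, 0] := by
      ext i j; fin_cases i <;> fin_cases j <;> simp [Matrix.mul_apply]; ring
    rw [this, map_sub, map_sub, component_smul, component_smul, map_pow, residue_residueLift]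
    simp [hyf, hyh]
  have hw_e : ∀ a d, serreWeight t' s' (diagGL a d) y =
      (κ ((a * d⁻¹ : (IsLocalRing.ResidueField O)ˣ) : IsLocalRing.ResidueField O) *
        lowestWeight t s a d) • y := fun a d =>
    X.component_diagGL hm hp2 hX κ _ a d (a * d⁻¹) fun a' d' ha hd => ⟨a' * d'⁻¹, by
      rw [map_mul, map_inv, ha, hd], by
      ext i j; fin_cases i <;> fin_cases j <;> simp [Matrix.mul_apply]⟩
  have hw_f : ∀ a d, serreWeight t' s' (diagGL a d) yf =
      (κ ((d * a⁻¹ : (IsLocalRing.ResidueField O)ˣ) : IsLocalRing.ResidueField O) *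
        lowestWeight t s a d) • yf := fun a d =>
    X.component_diagGL hm hp2 hX κ _ a d (d * a⁻¹) fun a' d' ha hd => ⟨d' * a'⁻¹, by
      rw [map_mul, map_inv, ha, hd], by
      ext i j; fin_cases i <;> fin_cases j <;> simp [Matrix.mul_apply]⟩
  have hw_h : ∀ a d, serreWeight t' s' (diagGL a d) yh = lowestWeight t s a d • yh := fun a d => by
    have := X.component_diagGL hm hp2 hX κ !![1, 0; 0, -1] a d 1 fun a' d' ha hd => ⟨1, by
      rw [map_one], by
      ext i j; fin_cases i <;> fin_cases j <;> simp [Matrix.mul_apply]⟩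
    simpa using this
  by_contra hy0
  obtain ⟨i, hi, hiy⟩ : ∃ i ≤ s', serreCoord s' i y ≠ 0 := by
    by_contra! h
    exact hy0 (eq_of_serreCoord_eq fun i hi => by rw [h i hi, map_zero])
  -- First constraint: `y` is in the image of a power of the raising operator at `μ`, which excludes
  -- small indices. Weak regularity makes the bound positive.
  have hiμ : p - 1 - s μ ≤ i μ := by
    obtain ⟨z, hz⟩ := X.exists_component_eq_raising_pow hm hp2 hX hs hκ
    by_contra! h
    refine hiy ?_
    rw [hy, hz]
    exact serreCoord_raising_pow p hp2 t' hs' μ _ h z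
  have hiμ0 : i μ ≠ 0 := by have := hs μ; omega
  obtain ⟨c, hc⟩ := exists_eq_smul_of_lowerUnip_fixed p hp2 t' hs' hlow_f
  -- When `yf = 0`, `yh` is fixed by the lower unipotents and has the lowest weight of `σ`, so it
  -- vanishes. Then `y` is fixed too and lives only at index `0`, against `i μ ≠ 0`.
  by_cases hf0 : yf = 0
  · have hyh0 : yh = 0 := eq_zero_of_lowest_weight hp2 hs hs' hne
      (fun x => by rw [hlow_h, hf0, smul_zero, add_zero]) hw_h
    obtain ⟨c', hc'⟩ := exists_eq_smul_of_lowerUnip_fixed p hp2 t' hs' (v := y) fun x => by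
      rw [hlow_e, hyh0, hf0, smul_zero, smul_zero, sub_zero, sub_zero]
    refine hiy ?_
    rw [hc', map_smul, serreCoord_serreVec hi (j := 0) fun κ => Nat.zero_le _, if_neg, smul_zero]
    rintro rfl
    exact hiμ0 rfl
  · have hw : ∀ a d, κ ((d * a⁻¹ : (IsLocalRing.ResidueField O)ˣ) : IsLocalRing.ResidueField O) *
        lowestWeight t s a d = lowestWeight t' s' a d := fun a d => by
      have h := hw_f a d
      have h2 : serreWeight t' s' (diagGL a d) yf = lowestWeight t' s' a d • yf := by
        rw [hc, map_smul, serreWeight_diagGL_zero, smul_comm]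
      rw [h2] at h
      exact (smul_left_injective F hf0 h).symm
    -- As `yf` has the lowest weight of `τ`, the index of `y` is read off from the ratio of the
    -- torus weights of `y` and `yf`, which is `κ(x)²` at `diag(x, 1)`. For `p = 3` the digit `2`
    -- equals `p - 1`, so the form of digit uniqueness with exceptional cases is used.
    have hi2 : i = Pi.single κ 2 := by
      have h1 : ∀ ν, i ν < p := fun ν => by
        have h1 : i ν ≤ s' ν := hi ν
        have := hs' ν
        omega
      have h2 : ∀ ν, (Pi.single κ 2 : (IsLocalRing.ResidueField O →+* F) → ℕ) ν < p := fun ν => by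
        rw [Pi.single_apply]; split_ifs <;> omega
      rcases eq_or_of_embProd_eq p h1 h2 fun x hx => by
        have h3 := serreCoord_weight (hw_e (Units.mk0 x hx) 1) hiy
        rw [← hw] at h3
        have hl := lowestWeight_ne_zero t s (Units.mk0 x hx) 1
        have hκx : κ x ≠ 0 := (map_ne_zero κ).2 hx
        simp only [inv_one, mul_one, one_mul, Units.val_one, embProd_one, Units.val_mk0,
          Units.val_inv_eq_inv_val, map_inv₀] at h3
        rw [embProd_single]
        field_simp at h3
        exact h3.symm
        with h | ⟨h, -⟩ | ⟨h, -⟩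
      · exact h
      · exact absurd (by rw [h]; rfl) hiμ0
      · have := congrFun h κ
        simp at this
    have hμκ : μ = κ := by
      by_contra h
      exact hiμ0 (by rw [hi2, Pi.single_eq_of_ne h])
    subst hμκ
    -- Now `κ = κ^p`, so there is a single embedding and each weight has one exponent.
    have huniq := subsingleton_of_pow_char_eq (κ := μ) hκ
    have h2 : 2 ≤ s' μ := by
      have : i μ ≤ s' μ := hi μ
      rwa [hi2, Pi.single_eq_same] at this
    have h3 : p - 1 - s μ ≤ 2 := by rwa [hi2, Pi.single_eq_same] at hiμ
    have h4 := hs μ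
    -- At `diag(x⁻¹, x)` the weights give `s' ≡ s + 2` modulo `p - 1`. Since `p - 3 ≤ s ≤ p - 2`,
    -- the reduced exponent is `s + 3 - p ≤ 1`, contradicting `2 ≤ s'`.
    have h5 : s' = Pi.single μ (s μ + 3 - p) := by
      refine eq_of_embProd_eq p hp2 hs' (fun ν => ?_) fun x hx => ?_
      · rw [Pi.single_apply]; split_ifs <;> omega
      have h6 := hw (Units.mk0 x hx)⁻¹ (Units.mk0 x hx)
      have hs1 : s = Pi.single μ (s μ) := funext fun ν => by rw [huniq ν, Pi.single_eq_same]
      have hμx : μ x ≠ 0 := (map_ne_zero μ).2 hx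
      have hμ1 : μ x ^ (p - 1) = 1 := by
        have := hκ x
        refine mul_right_cancel₀ hμx ?_
        rw [one_mul, ← pow_succ, Nat.sub_add_cancel (by omega), ← this]
      simp only [lowestWeight, inv_mul_cancel, detChar_one, one_mul, inv_inv, Units.val_mul,
        Units.val_mk0, map_mul] at h6
      rw [← h6, hs1, embProd_single, embProd_single, Pi.single_eq_same, ← sq, ← pow_add,
        show 2 + s μ = (s μ + 3 - p) + (p - 1) by omega, pow_add, hμ1, mul_one]
    have h7 := congrFun h5 μ
    rw [Pi.single_eq_same] at h7
    omega

/-- The first congruence subgroup acts trivially on a smooth extension (`p` odd). -/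
theorem matDefect_eq_zero_of_isEmpty (hs : ∀ κ, s κ ≤ p - 2) (hs' : ∀ κ, s' κ ≤ p - 2)
    (hne : IsEmpty ((serreWeight t s).Equiv (serreWeight t' s'))) :
    X.matDefect hm hp2 hX = 0 := by
  have hconj : ∀ (x : GL (Fin 2) O) (A : Matrix (Fin 2) (Fin 2) O), X.matDefect hm hp2 hX A = 0 →
      X.matDefect hm hp2 hX ((x : Matrix (Fin 2) (Fin 2) O) * A * (x⁻¹ : GL (Fin 2) O)) = 0 := by
    intro x A hA
    have h := X.matDefect_conj hm hp2 hX x A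
    rw [hA, LinearMap.comp_zero] at h
    ext v
    have h1 := LinearMap.congr_fun h (serreWeight t s (reductionHom O x)⁻¹ v)
    rwa [LinearMap.comp_apply, Representation.self_inv_apply] at h1
  -- Upper unipotents centralize `e`, so each component at `e` commutes with them; it kills the
  -- lowest weight vector, which generates `σ` under them.
  have he : ∀ c : O, X.matDefect hm hp2 hX !![0, c; 0, 0] = 0 := by
    intro c
    have h := X.matDefect_smul_eq_zero hm hp2 hX (A := !![0, 1; 0, 0]) (fun κ => by
      refine eq_zero_of_upperUnip_comm p hp2 t hs (serreWeight t' s') (fun x v => ?_)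
        (X.component_single_eq_zero hm hp2 hX hs hs' hne κ)
      have h := X.component_conj_apply hm hp2 hX κ (upperUnip (residueLift x)) !![0, 1; 0, 0] v
      rw [reductionHom_upperUnip, residue_residueLift] at h
      rw [h]
      congr 2
      change _ = !![1, residueLift x; 0, 1] * !![0, 1; 0, 0] * !![1, -residueLift x; 0, 1]
      ext i j; fin_cases i <;> fin_cases j <;> simp [Matrix.mul_apply]) c
    rw [← h]
    congr 1
    ext i j; fin_cases i <;> fin_cases j <;> simp
  have hf : ∀ c : O, X.matDefect hm hp2 hX !![0, 0; c, 0] = 0 := by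
    intro c
    rw [← hconj (swapGL O) _ (he c)]
    congr 1
    change _ = !![0, 1; 1, 0] * !![0, c; 0, 0] * !![0, 1; 1, 0]
    ext i j; fin_cases i <;> fin_cases j <;> simp [Matrix.mul_apply]
  -- Conjugating `c e` by a lower unipotent produces `c e - c h - c f`.
  have hh : ∀ c : O, X.matDefect hm hp2 hX !![c, 0; 0, -c] = 0 := by
    intro c
    have h := hconj (lowerUnip 1) _ (he c)
    have h1 : ((lowerUnip 1 : GL (Fin 2) O) : Matrix (Fin 2) (Fin 2) O) * !![0, c; 0, 0] *
        ((lowerUnip 1)⁻¹ : GL (Fin 2) O) = !![0, c; 0, 0] - !![c, 0; 0, -c] - !![0, 0; c, 0] := by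
      change !![1, 0; 1, 1] * !![0, c; 0, 0] * !![1, 0; -1, 1] = _
      ext i j; fin_cases i <;> fin_cases j <;> simp [Matrix.mul_apply]
    rw [h1, map_sub, map_sub, he, hf, zero_sub, sub_zero, neg_eq_zero] at h
    exact h
  -- Scalar matrices are fixed by conjugation, so their value is a `Γ`-equivariant map `σ → τ`. It
  -- sends the lowest weight vector to a vector of the same kind in `τ`, which is zero.
  have hz : ∀ c : O, X.matDefect hm hp2 hX !![c, 0; 0, c] = 0 := by
    intro c
    have hcomm : ∀ (x : GL (Fin 2) O) v, serreWeight t' s' (reductionHom O x)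
        (X.matDefect hm hp2 hX !![c, 0; 0, c] v) =
          X.matDefect hm hp2 hX !![c, 0; 0, c] (serreWeight t s (reductionHom O x) v) := by
      intro x v
      have h1 : (x : Matrix (Fin 2) (Fin 2) O) * !![c, 0; 0, c] * (x⁻¹ : GL (Fin 2) O) =
          !![c, 0; 0, c] := by
        have h2 : !![c, 0; 0, c] = c • (1 : Matrix (Fin 2) (Fin 2) O) := by
          ext i j; fin_cases i <;> fin_cases j <;> simp
        rw [h2, Matrix.mul_smul, Matrix.smul_mul, mul_one, Units.mul_inv]
      have h := LinearMap.congr_fun (X.matDefect_conj hm hp2 hX x !![c, 0; 0, c]) v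
      rw [h1] at h
      exact h.symm
    refine eq_zero_of_upperUnip_comm p hp2 t hs (serreWeight t' s') (fun x v => ?_) ?_
    · have h := hcomm (upperUnip (residueLift x)) v
      rw [reductionHom_upperUnip, residue_residueLift] at h
      exact h.symm
    · refine eq_zero_of_lowest_weight hp2 hs hs' hne (fun x => ?_) fun a d => ?_
      · have h := hcomm (lowerUnip (residueLift x)) (serreVec s 0)
        rwa [reductionHom_lowerUnip, residue_residueLift, serreWeight_lowerUnip_zero] at h
      · obtain ⟨a', rfl⟩ := exists_units_residue a
        obtain ⟨d', rfl⟩ := exists_units_residue d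
        have h := hcomm (diagGL a' d') (serreVec s 0)
        rwa [reductionHom_diagGL, serreWeight_diagGL_zero, map_smul] at h
  ext A : 1
  rw [AddMonoidHom.zero_apply]
  -- Doubling `A` avoids halves in the decomposition into traceless and scalar parts; `2` is
  -- invertible in `F`.
  have h2A : (2 : F) • X.matDefect hm hp2 hX A = 0 := by
    rw [two_smul, ← map_add]
    have : A + A = !![0, A 0 1 + A 0 1; 0, 0] + !![0, 0; A 1 0 + A 1 0, 0] +
        !![A 0 0 - A 1 1, 0; 0, -(A 0 0 - A 1 1)] + !![A 0 0 + A 1 1, 0; 0, A 0 0 + A 1 1] := by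
      ext i j; fin_cases i <;> fin_cases j <;> simp; ring
    rw [this, map_add, map_add, map_add, he, hf, hh, hz]
    simp
  refine (smul_eq_zero.1 h2A).resolve_left fun h => ?_
  have h' : ((2 : ℕ) : F) = 0 := by exact_mod_cast h
  rw [CharP.cast_eq_zero_iff F p] at h'
  exact absurd (Nat.le_of_dvd two_pos h') (by omega)

end RepExtension

namespace RepExtension

/-! ### The case `p = 2` -/

section Two

variable {O : Type u} [CommRing O] [IsLocalRing O] [Fintype (IsLocalRing.ResidueField O)]
  [CharP (IsLocalRing.ResidueField O) 2]
  {F : Type u} [Field F] [CharP F 2] [IsAlgClosed F]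
  [Fintype (IsLocalRing.ResidueField O →+* F)]
  {t t' : (IsLocalRing.ResidueField O →+* F) → ℤ}

theorem serreWeight_zero_diagGL {k : Type u} [Field k] [Fintype k] [Fintype (k →+* F)]
    (t : (k →+* F) → ℤ) (a d : kˣ) (v : SerreSpace F k 0) :
    serreWeight t 0 (diagGL a d) v = detChar t (a * d) • v := by
  have h : serreWeight t 0 (diagGL a d) = detChar t (a * d) • LinearMap.id := by
    refine serreSpace_hom_ext fun i hi => ?_
    obtain rfl : i = 0 := funext fun κ => Nat.le_zero.1 (hi κ)
    rw [serreWeight_diagGL, tsub_zero, embProd_zero, embProd_zero, mul_one, mul_one]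
    rfl
  rw [h]
  rfl

/-- In characteristic `2`, the action of the centre shows that the first congruence subgroup acts
trivially on an extension of non-isomorphic characters. -/
theorem defect_eq_zero_of_two
    (X : RepExtension (inflate (O := O) (serreWeight t 0)) (inflate (O := O) (serreWeight t' 0)))
    (hne : IsEmpty ((serreWeight t 0).Equiv (serreWeight t' 0))) {g : GL (Fin 2) O}
    (hg : g ∈ congruenceSubgroup O 1) : X.defect g = 0 := by
  have : Fact (Nat.Prime 2) := ⟨Nat.prime_two⟩
  by_contra hN
  obtain ⟨v, hv⟩ : ∃ v, X.defect g v ≠ 0 := by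
    by_contra! h
    exact hN (LinearMap.ext h)
  -- Scalar matrices commute with `g`, so a nonzero `defect g` intertwines the two central
  -- characters.
  have hsq : ∀ a : (IsLocalRing.ResidueField O)ˣ, detChar t (a * a) = detChar t' (a * a) := by
    intro a
    obtain ⟨a', rfl⟩ := exists_units_residue a
    have hc : diagGL a' a' * g * (diagGL a' a')⁻¹ = g := by
      rw [mul_inv_eq_iff_eq_mul]
      refine Units.ext ?_
      have h1 : ((diagGL a' a' : GL (Fin 2) O) : Matrix (Fin 2) (Fin 2) O) = (a' : O) • 1 := by
        ext i j; fin_cases i <;> fin_cases j <;> simp [diagGL]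
      rw [Units.val_mul, Units.val_mul, h1, Matrix.smul_mul, Matrix.mul_smul, one_mul, mul_one]
    have h := LinearMap.congr_fun (X.defect_conj hg (diagGL a' a')) v
    rw [hc, LinearMap.comp_apply, LinearMap.comp_apply, reductionHom_diagGL,
      serreWeight_zero_diagGL, serreWeight_zero_diagGL, map_smul] at h
    exact smul_left_injective F hv h
  -- In a finite field of characteristic `2` every unit is a square.
  have hdet : ∀ u : (IsLocalRing.ResidueField O)ˣ, detChar t u = detChar t' u := by
    intro u
    have hb := frobeniusEquiv_symm_pow_p (IsLocalRing.ResidueField O) 2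
      (u : IsLocalRing.ResidueField O)
    set b := (frobeniusEquiv (IsLocalRing.ResidueField O) 2).symm (u : IsLocalRing.ResidueField O)
    have hb0 : b ≠ 0 := by
      rintro h
      rw [h, zero_pow two_ne_zero] at hb
      exact u.ne_zero hb.symm
    have : u = Units.mk0 b hb0 * Units.mk0 b hb0 := Units.ext (by
      rw [← hb, Units.val_mul, Units.val_mk0, sq])
    rw [this]
    exact hsq _
  rw [serreWeight_congr_det 0 hdet] at hne
  exact hne.false (.refl _)

end Two

/-- The first congruence subgroup acts trivially on every smooth extension of non-isomorphic weakly
regular Serre weights, if `p` is a uniformizer. -/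
theorem ρ_eq_one_of_mem {O : Type u} [CommRing O] [IsLocalRing O]
    [Finite (IsLocalRing.ResidueField O)]
    {p : ℕ} [Fact p.Prime] [CharP (IsLocalRing.ResidueField O) p]
    {F : Type u} [Field F] [CharP F p] [IsAlgClosed F]
    {t t' : (IsLocalRing.ResidueField O →+* F) → ℤ} {s s' : (IsLocalRing.ResidueField O →+* F) → ℕ}
    (hm : IsLocalRing.maximalIdeal O = Ideal.span {(p : O)})
    (hs : ∀ κ, s κ ≤ p - 2) (hs' : ∀ κ, s' κ ≤ p - 2)
    (hne : IsEmpty ((serreWeight t s).Equiv (serreWeight t' s')))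
    (X : RepExtension (inflate (O := O) (serreWeight t s)) (inflate (O := O) (serreWeight t' s')))
    (hX : IsSmoothRep X.ρ) {g : GL (Fin 2) O} (hg : g ∈ congruenceSubgroup O 1) : X.ρ g = 1 := by
  classical
  let _ := Fintype.ofFinite (IsLocalRing.ResidueField O)
  have := finite_ringHom_of_charP p (IsLocalRing.ResidueField O) F
  let _ := Fintype.ofFinite (IsLocalRing.ResidueField O →+* F)
  have key : X.defect g = 0 := by
    rcases (Fact.out : p.Prime).two_le.eq_or_lt with rfl | hp2
    · obtain rfl : s = 0 := funext fun κ => Nat.le_zero.1 (hs κ)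
      obtain rfl : s' = 0 := funext fun κ => Nat.le_zero.1 (hs' κ)
      exact X.defect_eq_zero_of_two hne hg
    · obtain ⟨A, rfl⟩ := exists_eq_oneAddGL (natCast_mem hm) hm (n := 0) hg
      exact DFunLike.congr_fun (X.matDefect_eq_zero_of_isEmpty hm hp2 hX hs hs' hne) _
  ext x
  rw [X.ρ_apply_eq hg, key, LinearMap.zero_apply, map_zero, add_zero, Module.End.one_apply]

end RepExtension

/-! ### Unramified extensions of `ℚ_p` -/

section Integers

variable (p : ℕ) [Fact p.Prime] (K : Type u) [Field K] [Algebra ℚ_[p] K] [Algebra ℤ_[p] K]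
  [IsScalarTower ℤ_[p] ℚ_[p] K] [FiniteDimensional ℚ_[p] K]

theorem under_maximalIdeal_integerRing :
    (IsLocalRing.maximalIdeal (IntegerRing p K)).under ℤ_[p] = Ideal.span {(p : ℤ_[p])} := by
  rw [← PadicInt.maximalIdeal_eq_span_p]
  exact IsLocalRing.eq_maximalIdeal (Ideal.isMaximal_comap_of_isIntegral_of_isMaximal _)

theorem natCast_mem_maximalIdeal_integerRing :
    (p : IntegerRing p K) ∈ IsLocalRing.maximalIdeal (IntegerRing p K) := by
  have h : (p : ℤ_[p]) ∈ (IsLocalRing.maximalIdeal (IntegerRing p K)).under ℤ_[p] := by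
    rw [under_maximalIdeal_integerRing]
    exact Ideal.mem_span_singleton_self _
  rw [Ideal.under_def, Ideal.mem_comap, map_natCast] at h
  exact h

theorem charP_residueField_integerRing :
    CharP (IsLocalRing.ResidueField (IntegerRing p K)) p := by
  have h : ((p : ℕ) : IsLocalRing.ResidueField (IntegerRing p K)) = 0 := by
    rw [← map_natCast (IsLocalRing.residue (IntegerRing p K)), IsLocalRing.residue_eq_zero_iff]
    exact natCast_mem_maximalIdeal_integerRing p K
  exact (CharP.charP_iff_prime_eq_zero Fact.out).2 h

theorem finite_residueField_integerRing :
    Finite (IsLocalRing.ResidueField (IntegerRing p K)) := by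
  have : Module.Finite ℤ_[p] (IntegerRing p K) := IsIntegralClosure.finite ℤ_[p] ℚ_[p] K _
  have : IsLocalHom (algebraMap ℤ_[p] (IntegerRing p K)) := by
    refine ((IsLocalRing.local_hom_TFAE _).out 0 4).2 ?_
    rw [PadicInt.maximalIdeal_eq_span_p, ← under_maximalIdeal_integerRing p K, Ideal.under_def]
  exact IsLocalRing.ResidueField.finite_of_finite (R := ℤ_[p])
    (Finite.of_equiv _ PadicInt.residueField.symm.toEquiv)

/-- If the ramification index is `1`, then `p` is a uniformizer. -/
theorem maximalIdeal_integerRing_eq_span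
    (he : (IsLocalRing.maximalIdeal (IntegerRing p K)).ramificationIdx ℤ_[p] = 1) :
    IsLocalRing.maximalIdeal (IntegerRing p K) = Ideal.span {(p : IntegerRing p K)} := by
  -- The ramification index is a length over the localization at `𝔪`. Length one means a simple
  -- quotient, that is, `p` generates the maximal ideal there. Localizing a local ring at its
  -- maximal ideal changes nothing, so the statement transports back along `e`.
  rw [Ideal.ramificationIdx_def, ENat.toNat_eq_iff_eq_natCast, Nat.cast_one,
    Module.length_eq_one_iff, isSimpleModule_iff_isCoatom, ← Ideal.isMaximal_def,
    IsLocalRing.isMaximal_iff, under_maximalIdeal_integerRing, Ideal.map_span,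
    Set.image_singleton, map_natCast] at he
  let e := IsLocalization.atUnits (IntegerRing p K)
    (IsLocalRing.maximalIdeal (IntegerRing p K)).primeCompl
    (S := Localization.AtPrime (IsLocalRing.maximalIdeal (IntegerRing p K)))
    fun x hx => by simpa [Ideal.primeCompl, IsUnit.mem_submonoid_iff] using hx
  refine le_antisymm (fun x hx => ?_) ((Ideal.span_singleton_le_iff_mem _).2
    (natCast_mem_maximalIdeal_integerRing p K))
  have h1 : e x ∈ IsLocalRing.maximalIdeal
      (Localization.AtPrime (IsLocalRing.maximalIdeal (IntegerRing p K))) := by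
    rw [IsLocalRing.mem_maximalIdeal, mem_nonunits_iff] at hx ⊢
    rwa [MulEquiv.isUnit_map]
  rw [← he, Ideal.mem_span_singleton] at h1
  rw [Ideal.mem_span_singleton, ← map_dvd_iff e, map_natCast]
  exact h1

end Integers

/-! ### From triviality of `𝒦₁` to extensions and cohomology -/

section Consequences

variable {O : Type u} [CommRing O] [IsLocalRing O] {F : Type u} [Field F]
  {V W : Type u} [AddCommGroup V] [Module F V] [AddCommGroup W] [Module F W]
  {σ : Representation F (GL (Fin 2) (IsLocalRing.ResidueField O)) V}
  {τ : Representation F (GL (Fin 2) (IsLocalRing.ResidueField O)) W}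

/-- The inflation of an extension to `GL₂(O)`. -/
noncomputable def RepExtension.inflation (Y : RepExtension σ τ) :
    RepExtension (inflate (O := O) σ) (inflate (O := O) τ) where
  E := Y.E
  ρ := inflate Y.ρ
  incl := ⟨Y.incl.toLinearMap, fun g => Y.incl.isIntertwining' (reductionHom O g)⟩
  proj := ⟨Y.proj.toLinearMap, fun g => Y.proj.isIntertwining' (reductionHom O g)⟩
  injective := Y.injective
  exact := Y.exact
  surjective := Y.surjective

/-- A representation of `GL₂(O)` trivial on `𝒦₁`, as a representation of `GL₂(k)`. -/
noncomputable def deflate {E : Type u} [AddCommGroup E] [Module F E]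
    (ρ : Representation F (GL (Fin 2) O) E) (h : ∀ g ∈ congruenceSubgroup O 1, ρ g = 1) :
    Representation F (GL (Fin 2) (IsLocalRing.ResidueField O)) E :=
  have key : ∀ g g' : GL (Fin 2) O, reductionHom O g = reductionHom O g' → ρ g = ρ g' := by
    intro g g' hgg
    have h1 : ρ (g'⁻¹ * g) = 1 :=
      h _ (mem_congruenceSubgroup_one_of_reductionHom_eq_one (by
        rw [map_mul, map_inv, hgg, inv_mul_cancel]))
    rw [← mul_inv_cancel_left g' g, map_mul, h1, mul_one]
  { toFun := fun g => ρ (Function.surjInv reductionHom_surjective g)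
    map_one' := by
      rw [key _ 1 (by rw [Function.surjInv_eq reductionHom_surjective, map_one]), map_one]
    map_mul' := fun g g' => by
      rw [← map_mul]
      exact key _ _ (by simp only [map_mul, Function.surjInv_eq reductionHom_surjective]) }

theorem deflate_reductionHom {E : Type u} [AddCommGroup E] [Module F E]
    (ρ : Representation F (GL (Fin 2) O) E) (h : ∀ g ∈ congruenceSubgroup O 1, ρ g = 1)
    (g : GL (Fin 2) O) : deflate ρ h (reductionHom O g) = ρ g := by
  have h1 : ρ (g⁻¹ * Function.surjInv reductionHom_surjective (reductionHom O g)) = 1 :=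
    h _ (mem_congruenceSubgroup_one_of_reductionHom_eq_one (by
      rw [map_mul, map_inv, Function.surjInv_eq reductionHom_surjective, inv_mul_cancel]))
  change ρ (Function.surjInv reductionHom_surjective (reductionHom O g)) = ρ g
  rw [← mul_inv_cancel_left g (Function.surjInv _ _), map_mul, h1, mul_one]

/-- If `𝒦₁` acts trivially on all smooth extensions, then smooth extensions of `GL₂(O)` are the same
as extensions of `GL₂(k)`. -/
theorem smoothExtNeZero_inflate_iff
    (htriv : ∀ X : RepExtension (inflate (O := O) σ) (inflate (O := O) τ), IsSmoothRep X.ρ →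
      ∀ g ∈ congruenceSubgroup O 1, X.ρ g = 1) :
    SmoothExtNeZero (inflate (O := O) σ) (inflate (O := O) τ) ↔ ExtNeZero σ τ := by
  constructor
  · rintro ⟨X, hX, hns⟩
    have h := htriv X hX
    let Y : RepExtension σ τ :=
      { E := X.E
        ρ := deflate X.ρ h
        incl := ⟨X.incl.toLinearMap, fun g => by
          obtain ⟨g, rfl⟩ := reductionHom_surjective g
          rw [deflate_reductionHom]
          exact X.incl.isIntertwining' g⟩
        proj := ⟨X.proj.toLinearMap, fun g => by
          obtain ⟨g, rfl⟩ := reductionHom_surjective g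
          rw [deflate_reductionHom]
          exact X.proj.isIntertwining' g⟩
        injective := X.injective
        exact := X.exact
        surjective := X.surjective }
    refine ⟨Y, fun ⟨r, hr⟩ => hns ⟨⟨r.toLinearMap, fun g => ?_⟩, hr⟩⟩
    rw [← deflate_reductionHom X.ρ h]
    exact r.isIntertwining' (reductionHom O g)
  · rintro ⟨Y, hns⟩
    refine ⟨Y.inflation, fun v => ⟨1, fun g hg => ?_⟩, fun ⟨r, hr⟩ =>
      hns ⟨⟨r.toLinearMap, fun g => ?_⟩, hr⟩⟩
    · change Y.ρ (reductionHom O g) v = v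
      rw [reductionHom_eq_one hg, map_one]
      rfl
    · obtain ⟨g, rfl⟩ := reductionHom_surjective g
      exact r.isIntertwining' g

theorem quotTwoToResidue_mk (g : GL (Fin 2) O) :
    quotTwoToResidue O (g : QuotTwo O) = reductionHom O g := rfl

theorem quotTwoToResidue_surjective : Function.Surjective (quotTwoToResidue O) := fun g => by
  obtain ⟨g, rfl⟩ := reductionHom_surjective g
  exact ⟨_, quotTwoToResidue_mk g⟩

theorem dualTensorHom_tprod [FiniteDimensional F V]
    (g : GL (Fin 2) (IsLocalRing.ResidueField O)) (x : Module.Dual F V ⊗[F] W) :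
    dualTensorHom F V W (σ.dual.tprod τ g x) ∘ₗ σ g = τ g ∘ₗ dualTensorHom F V W x := by
  have h := LinearMap.congr_fun (Representation.dualTensorHom_comm σ τ g) x
  rw [LinearMap.comp_apply, LinearMap.comp_apply] at h
  ext v
  have h2 := LinearMap.congr_fun h (σ g v)
  rw [Representation.linHom_apply, LinearMap.comp_apply, LinearMap.comp_apply,
    Representation.inv_self_apply] at h2
  exact h2

/-- The extension of representations of `GL₂(O)` attached to a `1`-cocycle of `𝒦/𝒦₂` with values in
`σ^∨ ⊗ τ`. -/
noncomputable def cocycleExtension [FiniteDimensional F V]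
    (z : groupCohomology.cocycles₁ (dualTensorQuotTwo (O := O) σ τ)) :
    RepExtension (inflate (O := O) σ) (inflate (O := O) τ) where
  E := W × V
  ρ :=
    { toFun := fun g => LinearMap.prod
        (τ (reductionHom O g) ∘ₗ LinearMap.fst F W V +
          dualTensorHom F V W (z (g : QuotTwo O)) ∘ₗ σ (reductionHom O g) ∘ₗ LinearMap.snd F W V)
        (σ (reductionHom O g) ∘ₗ LinearMap.snd F W V)
      map_one' := by
        ext x <;> simp
      map_mul' := fun g h => by
        have hz := (groupCohomology.mem_cocycles₁_iff _).1 z.2 (g : QuotTwo O) (h : QuotTwo O)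
        have hz' : z ((g * h : GL (Fin 2) O) : QuotTwo O) =
          σ.dual.tprod τ (reductionHom O g) (z (h : QuotTwo O)) + z (g : QuotTwo O) := hz
        have h1 := fun v => LinearMap.congr_fun (dualTensorHom_tprod (σ := σ) (τ := τ)
          (reductionHom O g) (z (h : QuotTwo O))) v
        simp only [LinearMap.comp_apply] at h1
        refine LinearMap.ext fun x => Prod.ext ?_ ?_
        · change τ (reductionHom O (g * h)) x.1 +
              dualTensorHom F V W (z ((g * h : GL (Fin 2) O) : QuotTwo O))
                (σ (reductionHom O (g * h)) x.2) =
            τ (reductionHom O g) (τ (reductionHom O h) x.1 +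
              dualTensorHom F V W (z (h : QuotTwo O)) (σ (reductionHom O h) x.2)) +
              dualTensorHom F V W (z (g : QuotTwo O))
                (σ (reductionHom O g) (σ (reductionHom O h) x.2))
          rw [hz', map_mul, map_mul, map_mul, map_add, map_add, Module.End.mul_apply,
            Module.End.mul_apply, LinearMap.add_apply, h1, add_assoc]
        · simp }
  incl := ⟨LinearMap.inl F W V, fun g => by ext x <;> simp [inflate]⟩
  proj := ⟨LinearMap.snd F W V, fun g => by ext x <;> simp [inflate]⟩
  injective := LinearMap.inl_injective
  exact := fun x => ⟨fun h => ⟨x.1, Prod.ext rfl (Eq.symm h)⟩, by rintro ⟨w, rfl⟩; rfl⟩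
  surjective := LinearMap.snd_surjective

theorem cocycleExtension_ρ_apply [FiniteDimensional F V]
    (z : groupCohomology.cocycles₁ (dualTensorQuotTwo (O := O) σ τ)) (g : GL (Fin 2) O)
    (x : W × V) : (cocycleExtension z).ρ g x =
      (τ (reductionHom O g) x.1 + dualTensorHom F V W (z (g : QuotTwo O))
        (σ (reductionHom O g) x.2), σ (reductionHom O g) x.2) := rfl

theorem isSmoothRep_cocycleExtension [FiniteDimensional F V]
    (z : groupCohomology.cocycles₁ (dualTensorQuotTwo (O := O) σ τ)) :
    IsSmoothRep (cocycleExtension z).ρ := by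
  refine fun x => ⟨2, fun g hg => ?_⟩
  have h1 : (g : QuotTwo O) = 1 := (QuotientGroup.eq_one_iff g).2 hg
  have h2 := reductionHom_eq_one (congruenceSubgroup_anti one_le_two hg)
  refine (cocycleExtension_ρ_apply z g x).trans ?_
  rw [h1, h2, groupCohomology.cocycles₁_map_one]
  simp
  rfl

/-- On the extension built from `z`, an element `g ∈ 𝒦₁` acts with off-diagonal block `z(g)`. That
extension is smooth because `z` only sees `𝒦/𝒦₂`. -/
theorem cocycle_eq_zero [FiniteDimensional F V]
    (htriv : ∀ X : RepExtension (inflate (O := O) σ) (inflate (O := O) τ), IsSmoothRep X.ρ →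
      ∀ g ∈ congruenceSubgroup O 1, X.ρ g = 1)
    (z : groupCohomology.cocycles₁ (dualTensorQuotTwo (O := O) σ τ)) {g : GL (Fin 2) O}
    (hg : g ∈ congruenceSubgroup O 1) : z (g : QuotTwo O) = 0 := by
  have h := htriv _ (isSmoothRep_cocycleExtension z) g hg
  refine (dualTensorHomEquiv F V W).injective ?_
  rw [map_zero]
  ext v
  have h1 := (cocycleExtension_ρ_apply z g (0, v)).symm.trans (LinearMap.congr_fun h (0, v))
  have h2 := congrArg Prod.fst h1
  simp only [reductionHom_eq_one hg, map_zero, map_one, Module.End.one_apply, zero_add] at h2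
  exact h2

theorem resMap_eq_zero [FiniteDimensional F V]
    (htriv : ∀ X : RepExtension (inflate (O := O) σ) (inflate (O := O) τ), IsSmoothRep X.ρ →
      ∀ g ∈ congruenceSubgroup O 1, X.ρ g = 1) : resMap (O := O) σ τ = 0 := by
  rw [resMap, ← CategoryTheory.cancel_epi (groupCohomology.H1π _), groupCohomology.H1π_comp_map,
    CategoryTheory.Limits.comp_zero]
  ext z : 2
  rw [ModuleCat.hom_comp, LinearMap.comp_apply]
  have hz : groupCohomology.mapCocycles₁ (kernelModTwo O).subtype
      (CategoryTheory.CategoryStruct.id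
        (Rep.res (kernelModTwo O).subtype (dualTensorQuotTwo (O := O) σ τ))) z = 0 := by
    refine groupCohomology.cocycles₁_ext fun g => ?_
    obtain ⟨_, ⟨g, hg, rfl⟩⟩ := g
    exact cocycle_eq_zero htriv z hg
  refine (congrArg _ hz).trans ?_
  rw [map_zero]
  rfl

/-- Injectivity: a vector bounding the inflated cocycle already bounds the original one, as `𝒦/𝒦₂ →
Γ` is onto. Surjectivity: a cocycle vanishing on `𝒦₁/𝒦₂` is constant on its cosets and descends to
`Γ`. -/
theorem isIso_infMap [FiniteDimensional F V]
    (htriv : ∀ X : RepExtension (inflate (O := O) σ) (inflate (O := O) τ), IsSmoothRep X.ρ →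
      ∀ g ∈ congruenceSubgroup O 1, X.ρ g = 1) :
    CategoryTheory.IsIso (infMap (O := O) σ τ) := by
  rw [CategoryTheory.ConcreteCategory.isIso_iff_bijective]
  constructor
  · rw [injective_iff_map_eq_zero]
    intro x hx
    induction x using groupCohomology.H1_induction_on with | @h z =>
    have h1 := (groupCohomology.H1π_comp_map_apply (quotTwoToResidue O)
      (CategoryTheory.CategoryStruct.id (dualTensorQuotTwo (O := O) σ τ)) z).symm.trans hx
    obtain ⟨y, hy⟩ := (groupCohomology.H1π_eq_zero_iff _).1 h1
    refine (groupCohomology.H1π_eq_zero_iff _).2 ⟨y, funext fun g => ?_⟩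
    obtain ⟨g, rfl⟩ := quotTwoToResidue_surjective g
    exact congrFun hy g
  · intro x
    induction x using groupCohomology.H1_induction_on with | @h z =>
    have hinv : ∀ g h : QuotTwo O, quotTwoToResidue O g = quotTwoToResidue O h → z g = z h := by
      intro g h hgh
      have hk : z (g⁻¹ * h) = 0 := by
        obtain ⟨a, ha⟩ := QuotientGroup.mk_surjective (g⁻¹ * h)
        rw [← ha]
        refine cocycle_eq_zero htriv z (mem_congruenceSubgroup_one_of_reductionHom_eq_one ?_)
        rw [← quotTwoToResidue_mk, ha, map_mul, map_inv, hgh, inv_mul_cancel]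
      have h1 := (groupCohomology.mem_cocycles₁_iff _).1 z.2 g (g⁻¹ * h)
      rw [mul_inv_cancel_left] at h1
      have h2 : z h = (dualTensorQuotTwo (O := O) σ τ).ρ g (z (g⁻¹ * h)) + z g := h1
      rw [h2, hk, map_zero, zero_add]
    let f : GL (Fin 2) (IsLocalRing.ResidueField O) → dualTensor (O := O) σ τ := fun g =>
      z (Function.surjInv quotTwoToResidue_surjective g)
    have hf : ∀ g : QuotTwo O, f (quotTwoToResidue O g) = z g := fun g =>
      hinv _ _ (Function.surjInv_eq quotTwoToResidue_surjective _)
    have hfz : f ∈ groupCohomology.cocycles₁ (dualTensor (O := O) σ τ) := by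
      rw [groupCohomology.mem_cocycles₁_iff]
      intro g h
      obtain ⟨g, rfl⟩ := quotTwoToResidue_surjective g
      obtain ⟨h, rfl⟩ := quotTwoToResidue_surjective h
      rw [← map_mul, hf, hf, hf]
      exact (groupCohomology.mem_cocycles₁_iff _).1 z.2 g h
    refine ⟨groupCohomology.H1π _ ⟨f, hfz⟩, ?_⟩
    refine (groupCohomology.H1π_comp_map_apply (quotTwoToResidue O)
      (CategoryTheory.CategoryStruct.id (dualTensorQuotTwo (O := O) σ τ)) ⟨f, hfz⟩).trans ?_
    congr 1
    exact groupCohomology.cocycles₁_ext hf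

end Consequences

theorem proposition2p12 (p : ℕ) [Fact p.Prime]
    -- `K` is a finite extension of `ℚ_p` with `e(K/ℚ_p) = 1`
    (K : Type u) [Field K] [Algebra ℚ_[p] K] [Algebra ℤ_[p] K] [IsScalarTower ℤ_[p] ℚ_[p] K]
    [FiniteDimensional ℚ_[p] K]
    (he : (IsLocalRing.maximalIdeal (IntegerRing p K)).ramificationIdx ℤ_[p] = 1)
    -- `F` is an algebraic closure of `𝔽_p`
    (F : Type u) [Field F] [Algebra (ZMod p) F] [IsAlgClosure (ZMod p) F]
    (t t' : (IsLocalRing.ResidueField (IntegerRing p K) →+* F) → ℤ)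
    (s s' : (IsLocalRing.ResidueField (IntegerRing p K) →+* F) → ℕ)
    -- both weights are weakly regular
    (hs : ∀ κ, s κ ≤ p - 2) (hs' : ∀ κ, s' κ ≤ p - 2)
    -- the weights are not isomorphic
    (hne : IsEmpty ((serreWeight t s).Equiv (serreWeight t' s')))
    (hocc : OccursInH1 (serreWeight t s) (serreWeight t' s')) :
    resMap (serreWeight t s) (serreWeight t' s') = 0 ∧
      CategoryTheory.IsIso (infMap (serreWeight t s) (serreWeight t' s')) ∧
      (SmoothExtNeZero (inflate (serreWeight t s)) (inflate (serreWeight t' s')) ↔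
        ExtNeZero (serreWeight t s) (serreWeight t' s')) := by
  have : IsAlgClosed F := IsAlgClosure.isAlgClosed (ZMod p)
  have : CharP F p := charP_of_injective_algebraMap (algebraMap (ZMod p) F).injective p
  have := charP_residueField_integerRing p K
  have := finite_residueField_integerRing p K
  have := finite_ringHom_of_charP p (IsLocalRing.ResidueField (IntegerRing p K)) F
  have : FiniteDimensional F (SerreSpace F (IsLocalRing.ResidueField (IntegerRing p K)) s) := by
    let _ := Fintype.ofFinite (IsLocalRing.ResidueField (IntegerRing p K))
    let _ := Fintype.ofFinite (IsLocalRing.ResidueField (IntegerRing p K) →+* F)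
    exact Module.Finite.of_basis (serreBasis s)
  -- Ramification index one enters only here, by making `p` a uniformizer.
  have htriv : ∀ X : RepExtension (inflate (O := IntegerRing p K) (serreWeight t s))
      (inflate (O := IntegerRing p K) (serreWeight t' s')), IsSmoothRep X.ρ →
      ∀ g ∈ congruenceSubgroup (IntegerRing p K) 1, X.ρ g = 1 := fun X hX g hg =>
    X.ρ_eq_one_of_mem (maximalIdeal_integerRing_eq_span p K he) hs hs' hne hX hg
  exact ⟨resMap_eq_zero htriv, isIso_infMap htriv, smoothExtNeZero_inflate_iff htriv⟩
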